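/- Let $M$ be a smooth manifold of dimension $n$ with a smooth pseudo-Riemannian metric $g$ of arbitrary signature and Levi-Civita connection $\nabla$, and suppose that $(M,g)$ is an Einstein space, i.e. $R_{ab}=\Lambda g_{ab}$. Let $2\le p<n$, and let $Y$ be a smooth conformal Killing–Yano (CKY) tensor of order $p$: a totally skew-symmetric tensor such that $$\nabla_a Y_{b_1b_2\cdots b_p}+\nabla_{b_1}Y_{ab_2\cdots b_p}=2\,g_{a[b_1}k_{b_2\cdots b_p]}+2\,g_{b_1[a}k_{b_2\cdots b_p]}$$ for some skew-symmetric tensor $k$ of order $p-1$. A Killing–Yano (KY) tensor is a skew-symmetric tensor satisfying the CKY equation with zero right-hand side. Let $$h_{b_2\cdots b_p}=\frac{p}{2(n+1-p)}\,\nabla^aY_{ab_2\cdots b_p}$$ be the (normalized) divergence of $Y$, and suppose that $h$ is not identically zero. Then $h$ is a KY tensor of order $p-1$ if and only if $$C^{a\hat f}{}_{\hat e(c}\,Y_{d)a\hat F}=0,\qquad\text{where}\qquad C^{a\hat f}{}_{\hat e c}\,Y_{da\hat F}:=\sum_{i=3}^{p}C^{af}{}_{e_ic}\,Y_{da\,e_3\cdots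 e_{i-1}\,f\,e_{i+1}\cdots e_p},$$ $C_{abcd}$ is the Weyl tensor of $g$, and round brackets denote symmetrization in $c,d$. For $p=2$ the sum is empty, so the condition holds automatically, and the vector field $h^a$ metrically dual to $h$ is a Killing vector field. -/

import Mathlib

open scoped Manifold ContDiff

noncomputable section

namespace KillingYano

/-! ### Components in a chart

Tensors are written in components, with indices in `Fin n`. A covariant tensor field of rank `k`
is represented, on the target of a chart, by its array of component functions
`EuclideanSpace ℝ (Fin n) → (Fin k → Fin n) → ℝ`; a multi-index `b_1 b_2 ⋯ b_k` is a function
`Fin k → Fin n`, and `Fin.cons a b` is the multi-index `a b_1 ⋯ b_k`. -/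

/-- The partial derivative `∂_i f` at the point `u` of `ℝⁿ`. -/
def pd {n : ℕ} (i : Fin n) (f : EuclideanSpace ℝ (Fin n) → ℝ) (u : EuclideanSpace ℝ (Fin n)) : ℝ :=
  fderiv ℝ f u (EuclideanSpace.single i 1)

/-- The anti-symmetrization `T_{[b_1 ⋯ b_k]} = (1/k!) ∑_σ sgn(σ) T_{b_σ(1) ⋯ b_σ(k)}`. -/
def skewPart {n k : ℕ} (T : (Fin k → Fin n) → ℝ) (b : Fin k → Fin n) : ℝ :=
  (1 / (k.factorial : ℝ)) *
    ∑ σ : Equiv.Perm (Fin k), ((Equiv.Perm.sign σ : ℤ) : ℝ) * T (b ∘ σ)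

section Manifold

variable {n : ℕ} {M : Type*} [TopologicalSpace M] [ChartedSpace (EuclideanSpace ℝ (Fin n)) M]

/-- The coordinate vector `∂_i` of the chart `e`, at the point with coordinates `u`. -/
def coordVec (e : OpenPartialHomeomorph M (EuclideanSpace ℝ (Fin n)))
    (u : EuclideanSpace ℝ (Fin n)) (i : Fin n) : TangentSpace (𝓡 n) (e.symm u) :=
  mfderiv (𝓡 n) (𝓡 n) e.symm u (EuclideanSpace.single i (1 : ℝ))

/-- The components `T(∂_{b_1}, …, ∂_{b_k})`, in the chart `e`, of a field `T` of alternating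
`k`-linear forms on the tangent spaces. -/
def formComp {k : ℕ} (T : ∀ x : M, (TangentSpace (𝓡 n) x) [⋀^Fin k]→ₗ[ℝ] ℝ)
    (e : OpenPartialHomeomorph M (EuclideanSpace ℝ (Fin n)))
    (u : EuclideanSpace ℝ (Fin n)) (b : Fin k → Fin n) : ℝ :=
  T (e.symm u) (fun j => coordVec e u (b j))

variable (n M) in
/-- A smooth pseudo-Riemannian metric, of arbitrary signature, on a manifold of dimension `n`. -/
structure PseudoRiemannianMetric where
  /-- the bilinear form on each tangent space -/
  form : ∀ x : M, TangentSpace (𝓡 n) x →ₗ[ℝ] TangentSpace (𝓡 n) x →ₗ[ℝ] ℝ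
  symm : ∀ (x : M) (v w : TangentSpace (𝓡 n) x), form x v w = form x w v
  nondegenerate : ∀ (x : M) (v : TangentSpace (𝓡 n) x), (∀ w, form x v w = 0) → v = 0
  smooth : ∀ e ∈ IsManifold.maximalAtlas (𝓡 n) ∞ M, ∀ i j : Fin n,
    ContDiffOn ℝ ∞ (fun u => form (e.symm u) (coordVec e u i) (coordVec e u j)) e.target

variable (n M) in
/-- A smooth totally skew-symmetric covariant tensor field of rank `k`. -/
structure SkewTensorField (k : ℕ) where
  /-- the alternating form on each tangent space -/
  toFun : ∀ x : M, (TangentSpace (𝓡 n) x) [⋀^Fin k]→ₗ[ℝ] ℝ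
  smooth : ∀ e ∈ IsManifold.maximalAtlas (𝓡 n) ∞ M, ∀ b : Fin k → Fin n,
    ContDiffOn ℝ ∞ (fun u => formComp toFun e u b) e.target

/-- The zero tensor field. -/
instance {k : ℕ} : Zero (SkewTensorField n M k) where
  zero :=
    { toFun := fun _ => 0
      smooth := fun _ _ _ => contDiffOn_const }

/-- The components of a skew-symmetric tensor field in the chart `e`. -/
def SkewTensorField.comp {k : ℕ} (T : SkewTensorField n M k)
    (e : OpenPartialHomeomorph M (EuclideanSpace ℝ (Fin n)))
    (u : EuclideanSpace ℝ (Fin n)) (b : Fin k → Fin n) : ℝ :=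
  formComp T.toFun e u b

namespace PseudoRiemannianMetric

variable (g : PseudoRiemannianMetric n M) (e : OpenPartialHomeomorph M (EuclideanSpace ℝ (Fin n)))

/-- The components `g_{ij}`. -/
def comp (u : EuclideanSpace ℝ (Fin n)) (i j : Fin n) : ℝ :=
  g.form (e.symm u) (coordVec e u i) (coordVec e u j)

/-- The components `g^{ij}` of the inverse metric. -/
def inv (u : EuclideanSpace ℝ (Fin n)) (i j : Fin n) : ℝ :=
  (Matrix.of (g.comp e u))⁻¹ i j

/-- The Christoffel symbols of the Levi-Civita connection,
`Γ^c_{ab} = (1/2) g^{cl} (∂_a g_{bl} + ∂_b g_{al} - ∂_l g_{ab})`. -/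
def christoffel (u : EuclideanSpace ℝ (Fin n)) (c a b : Fin n) : ℝ :=
  (1 / 2) * ∑ l, g.inv e u c l *
    (pd a (fun v => g.comp e v b l) u + pd b (fun v => g.comp e v a l) u
      - pd l (fun v => g.comp e v a b) u)

/-- The covariant derivative
`∇_a T_{b_1 ⋯ b_k} = ∂_a T_{b_1 ⋯ b_k} - ∑_j Γ^c_{a b_j} T_{b_1 ⋯ c ⋯ b_k}` (`c` in place `j`)
of the tensor with components `T` in the chart `e`. -/
def nabla {k : ℕ} (T : EuclideanSpace ℝ (Fin n) → (Fin k → Fin n) → ℝ)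
    (u : EuclideanSpace ℝ (Fin n)) (a : Fin n) (b : Fin k → Fin n) : ℝ :=
  pd a (fun v => T v b) u
    - ∑ j : Fin k, ∑ c : Fin n, g.christoffel e u c a (b j) * T u (Function.update b j c)

/-- The curvature `R_{abc}{}^d`, with the convention
`(∇_a ∇_b - ∇_b ∇_a) ω_c = R_{abc}{}^d ω_d`. -/
def riemannUp (u : EuclideanSpace ℝ (Fin n)) (a b c d : Fin n) : ℝ :=
  pd b (fun v => g.christoffel e v d a c) u - pd a (fun v => g.christoffel e v d b c) u
    + ∑ f, (g.christoffel e u f a c * g.christoffel e u d b f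
      - g.christoffel e u f b c * g.christoffel e u d a f)

/-- The Riemann tensor `R_{abcd} = g_{df} R_{abc}{}^f`. -/
def riemann (u : EuclideanSpace ℝ (Fin n)) (a b c d : Fin n) : ℝ :=
  ∑ f, g.comp e u d f * g.riemannUp e u a b c f

/-- The Ricci tensor `R_{ab} = R^c{}_{acb}`. -/
def ricci (u : EuclideanSpace ℝ (Fin n)) (a b : Fin n) : ℝ :=
  ∑ c, ∑ d, g.inv e u c d * g.riemann e u d a c b

/-- The scalar curvature `R = g^{ab} R_{ab}`. -/
def scalarCurv (u : EuclideanSpace ℝ (Fin n)) : ℝ :=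
  ∑ a, ∑ b, g.inv e u a b * g.ricci e u a b

/-- The Weyl tensor `C_{abcd}` (in dimension `n ≥ 3`). -/
def weyl (u : EuclideanSpace ℝ (Fin n)) (a b c d : Fin n) : ℝ :=
  g.riemann e u a b c d
    - (1 / ((n : ℝ) - 2)) *
      (g.comp e u a c * g.ricci e u b d - g.comp e u a d * g.ricci e u b c
        - g.comp e u b c * g.ricci e u a d + g.comp e u b d * g.ricci e u a c)
    + (g.scalarCurv e u / (((n : ℝ) - 1) * ((n : ℝ) - 2))) *
      (g.comp e u a c * g.comp e u b d - g.comp e u a d * g.comp e u b c)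

/-- The Weyl tensor with the first pair of indices raised, `C^{ab}{}_{cd}`. -/
def weylUp (u : EuclideanSpace ℝ (Fin n)) (a b c d : Fin n) : ℝ :=
  ∑ s, ∑ t, g.inv e u a s * g.inv e u b t * g.weyl e u s t c d

/-- `(M, g)` is an Einstein space: `R_{ab} = Λ g_{ab}` in every chart. -/
def IsEinstein : Prop :=
  ∃ Λ : M → ℝ, ∀ e ∈ IsManifold.maximalAtlas (𝓡 n) ∞ M, ∀ u ∈ e.target, ∀ a b : Fin n,
    g.ricci e u a b = Λ (e.symm u) * g.comp e u a b

/-- The conformal Killing-Yano equation for `Y` of order `k + 1` with right-hand side given by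
the skew-symmetric tensor `h` of order `k`:
`∇_a Y_{b_1 b_2 ⋯} + ∇_{b_1} Y_{a b_2 ⋯} = 2 g_{a[b_1} h_{b_2 ⋯]} + 2 g_{b_1[a} h_{b_2 ⋯]}`
in every chart. -/
def CKYEquation {k : ℕ} (Y : SkewTensorField n M (k + 1)) (h : SkewTensorField n M k) : Prop :=
  ∀ e ∈ IsManifold.maximalAtlas (𝓡 n) ∞ M, ∀ u ∈ e.target, ∀ (a b₁ : Fin n) (b : Fin k → Fin n),
    g.nabla e (Y.comp e) u a (Fin.cons b₁ b) + g.nabla e (Y.comp e) u b₁ (Fin.cons a b)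
      = 2 * skewPart (fun c : Fin (k + 1) → Fin n =>
            g.comp e u a (c 0) * h.comp e u (Fin.tail c)) (Fin.cons b₁ b)
        + 2 * skewPart (fun c : Fin (k + 1) → Fin n =>
            g.comp e u b₁ (c 0) * h.comp e u (Fin.tail c)) (Fin.cons a b)

/-- `Y` is a conformal Killing-Yano tensor. -/
def IsCKY {k : ℕ} (Y : SkewTensorField n M (k + 1)) : Prop :=
  ∃ h : SkewTensorField n M k, g.CKYEquation Y h

/-- `A` is a Killing-Yano tensor: it obeys the conformal Killing-Yano equation with `h = 0`,
that is, `∇_a A_{b_1 b_2 ⋯} + ∇_{b_1} A_{a b_2 ⋯} = 0`. -/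
def IsKillingYano {k : ℕ} (A : SkewTensorField n M (k + 1)) : Prop :=
  g.CKYEquation A 0

/-- `h` is the (normalized) divergence of the tensor `Y` of order `p = k + 1`:
`h_{b_2 ⋯ b_p} = p / (2 (n + 1 - p)) ∇^a Y_{a b_2 ⋯ b_p}` in every chart. -/
def IsDivergence {k : ℕ} (Y : SkewTensorField n M (k + 1)) (h : SkewTensorField n M k) : Prop :=
  ∀ e ∈ IsManifold.maximalAtlas (𝓡 n) ∞ M, ∀ u ∈ e.target, ∀ b : Fin k → Fin n,
    h.comp e u b = (((k + 1 : ℕ) : ℝ) / (2 * ((n : ℝ) + 1 - ((k + 1 : ℕ) : ℝ)))) *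
      ∑ a, ∑ c, g.inv e u a c * g.nabla e (Y.comp e) u c (Fin.cons a b)

/-- The expression
`C^{a f̂}{}_{ê c} Y_{d a F̂} = ∑_i C^{a f}{}_{e_i c} Y_{d a e_3 ⋯ f ⋯ e_p}` (`f` in place of `e_i`),
where `Y` has order `p = q + 2` and the multi-index `E = e_3 ⋯ e_p` has `q` entries. -/
def weylContr {q : ℕ} (Y : SkewTensorField n M (q + 2)) (u : EuclideanSpace ℝ (Fin n))
    (c d : Fin n) (E : Fin q → Fin n) : ℝ :=
  ∑ i : Fin q, ∑ a : Fin n, ∑ f : Fin n,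
    g.weylUp e u a f (E i) c * Y.comp e u (Fin.cons d (Fin.cons a (Function.update E i f)))

/-- The algebraic condition `C^{a f̂}{}_{ê (c} Y_{d) a F̂} = 0`, in every chart. -/
def WeylCondition {q : ℕ} (Y : SkewTensorField n M (q + 2)) : Prop :=
  ∀ e ∈ IsManifold.maximalAtlas (𝓡 n) ∞ M, ∀ u ∈ e.target, ∀ (c d : Fin n) (E : Fin q → Fin n),
    (1 / 2 : ℝ) * (g.weylContr e Y u c d E + g.weylContr e Y u d c E) = 0

/-- The vector field `X` is a Killing vector field: `∇_a X_b + ∇_b X_a = 0` in every chart,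
where `X_b = g(X, ∂_b)`. -/
def IsKillingVector (X : ∀ x : M, TangentSpace (𝓡 n) x) : Prop :=
  ∀ e ∈ IsManifold.maximalAtlas (𝓡 n) ∞ M, ∀ u ∈ e.target, ∀ a b : Fin n,
    g.nabla e (fun v (i : Fin 1 → Fin n) => g.form (e.symm v) (X (e.symm v)) (coordVec e v (i 0)))
        u a (fun _ => b)
      + g.nabla e
        (fun v (i : Fin 1 → Fin n) => g.form (e.symm v) (X (e.symm v)) (coordVec e v (i 0)))
        u b (fun _ => a) = 0

end PseudoRiemannianMetric

end Manifold

end KillingYano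

end

/-! The proof computes one trace of the commutator of second covariant derivatives of `Y` in two
ways, with `p = q + 2`.

Write the CKY equation as `∇_a Y_{bB} + ∇_b Y_{aB} = r t_{abB}(h)`, where `t` is `traceTerm` and `r
= 2/p`; tracing shows that its right-hand side is governed by the divergence `h`. Differentiate it,
and contract `(∇_c ∇_a - ∇_a ∇_c) Y_{bdE}` with `g^{ab}`, symmetrizing in `c, d`. The differentiated
equation evaluates both halves (`sum_mul_sub_add_sum_mul_sub`): the result is `r` times `(n - p)(∇_c
h_{dE} + ∇_d h_{cE}) + t_{cdE}(δh)`, where `δh` is the divergence of `h`.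

The Ricci identity `nabla_nabla_sub` turns the same commutator into curvature terms
(`curvatureTrace_add_swap`). The Ricci term is a multiple of `Y_{cdE}` on an Einstein space, and
vanishes on symmetrization; so does the curvature term acting on the slot `d`, by pair symmetry.
Bianchi turns the slots of `E` into half of the Weyl expression: the non-Weyl part of the curvature
contributes only terms skew in `c, d`. Equating the two results gives `weylContr_add_swap`.

If `h` is KY, then `δh = 0` by tracing, so the Weyl expression vanishes. Conversely, if that
expression vanishes, the trace of the identity over `c, d` reads `4(n - p + 1) δh = 0`; hence `δh =
0`, and since `n - p ≠ 0` the remaining term says that `h` is KY. -/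

namespace KillingYano

/-! ### Partial derivatives -/

section PartialDerivatives

variable {n : ℕ} {s : Set (EuclideanSpace ℝ (Fin n))} {u : EuclideanSpace ℝ (Fin n)}
  {f₁ f₂ : EuclideanSpace ℝ (Fin n) → ℝ}

theorem differentiableAt_of_contDiffOn (hs : IsOpen s) (hu : u ∈ s) (h : ContDiffOn ℝ ∞ f₁ s) :
    DifferentiableAt ℝ f₁ u :=
  (h.contDiffAt (hs.mem_nhds hu)).differentiableAt (by simp)

theorem pd_add (i : Fin n) (h₁ : DifferentiableAt ℝ f₁ u) (h₂ : DifferentiableAt ℝ f₂ u) :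
    pd i (fun v => f₁ v + f₂ v) u = pd i f₁ u + pd i f₂ u := by
  simp [pd, fderiv_fun_add h₁ h₂]

theorem pd_sub (i : Fin n) (h₁ : DifferentiableAt ℝ f₁ u) (h₂ : DifferentiableAt ℝ f₂ u) :
    pd i (fun v => f₁ v - f₂ v) u = pd i f₁ u - pd i f₂ u := by
  simp [pd, fderiv_fun_sub h₁ h₂]

theorem pd_mul (i : Fin n) (h₁ : DifferentiableAt ℝ f₁ u) (h₂ : DifferentiableAt ℝ f₂ u) :
    pd i (fun v => f₁ v * f₂ v) u = pd i f₁ u * f₂ u + f₁ u * pd i f₂ u := by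
  simp [pd, fderiv_fun_mul h₁ h₂]
  ring

theorem pd_const_mul (i : Fin n) (r : ℝ) (h₁ : DifferentiableAt ℝ f₁ u) :
    pd i (fun v => r * f₁ v) u = r * pd i f₁ u := by
  simp [pd, fderiv_const_mul h₁]

theorem pd_sum (i : Fin n) {ι : Type*} (t : Finset ι) {F : ι → EuclideanSpace ℝ (Fin n) → ℝ}
    (h : ∀ j ∈ t, DifferentiableAt ℝ (F j) u) :
    pd i (fun v => ∑ j ∈ t, F j v) u = ∑ j ∈ t, pd i (F j) u := by
  simp [pd, fderiv_fun_sum h]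

theorem pd_congr (i : Fin n) (hs : IsOpen s) (hu : u ∈ s) (h : ∀ v ∈ s, f₁ v = f₂ v) :
    pd i f₁ u = pd i f₂ u := by
  have : f₁ =ᶠ[nhds u] f₂ := Filter.eventually_of_mem (hs.mem_nhds hu) h
  simp [pd, this.fderiv_eq]

theorem pd_zero (i : Fin n) : pd i (fun _ => 0) u = 0 := by
  simp [pd]

theorem contDiffOn_pd (hs : IsOpen s) (i : Fin n) (h : ContDiffOn ℝ ∞ f₁ s) :
    ContDiffOn ℝ ∞ (pd i f₁) s :=
  (h.fderiv_of_isOpen hs (by simp)).clm_apply contDiffOn_const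

theorem pd_comm (hs : IsOpen s) (hu : u ∈ s) (h : ContDiffOn ℝ ∞ f₁ s) (i j : Fin n) :
    pd i (pd j f₁) u = pd j (pd i f₁) u := by
  have hd : DifferentiableAt ℝ (fderiv ℝ f₁) u :=
    (((h.fderiv_of_isOpen hs (m := ∞) (by simp)).contDiffAt
      (hs.mem_nhds hu))).differentiableAt (by simp)
  have hsymm : IsSymmSndFDerivAt ℝ f₁ u :=
    (h.contDiffAt (hs.mem_nhds hu)).isSymmSndFDerivAt (by
      simp only [minSmoothness_of_isRCLikeNormedField]
      exact WithTop.coe_le_coe.2 le_top)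
  have key : ∀ k l : Fin n, pd k (pd l f₁) u =
      fderiv ℝ (fderiv ℝ f₁) u (EuclideanSpace.single k 1) (EuclideanSpace.single l 1) := by
    intro k l
    unfold pd
    rw [fderiv_clm_apply hd (differentiableAt_const _)]
    simp
  rw [key, key]
  exact hsymm _ _

end PartialDerivatives

/-! ### The metric in a chart -/

section Chart

variable {n : ℕ} {M : Type*} [TopologicalSpace M] [ChartedSpace (EuclideanSpace ℝ (Fin n)) M]
  {e : OpenPartialHomeomorph M (EuclideanSpace ℝ (Fin n))} {u : EuclideanSpace ℝ (Fin n)}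

theorem mdifferentiable_of_mem_maximalAtlas (he : e ∈ IsManifold.maximalAtlas (𝓡 n) ∞ M) :
    e.MDifferentiable (𝓡 n) (𝓡 n) :=
  ⟨(contMDiffOn_of_mem_maximalAtlas he).mdifferentiableOn (by simp),
    (contMDiffOn_symm_of_mem_maximalAtlas he).mdifferentiableOn (by simp)⟩

theorem mfderiv_symm_eq_sum (v : EuclideanSpace ℝ (Fin n)) :
    mfderiv (𝓡 n) (𝓡 n) e.symm u v = ∑ i, v i • coordVec e u i := by
  unfold coordVec
  have hv : v = ∑ i, v i • EuclideanSpace.single i (1 : ℝ) := by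
    ext j
    simp [Finset.sum_apply, Pi.single_apply]
  conv_lhs => rw [hv]
  refine (map_sum (mfderiv (𝓡 n) (𝓡 n) e.symm u) _ _).trans ?_
  refine Finset.sum_congr rfl fun i _ => ?_
  exact map_smul (mfderiv (𝓡 n) (𝓡 n) e.symm u) _ _

theorem mfderiv_symm_bijective (he : e ∈ IsManifold.maximalAtlas (𝓡 n) ∞ M) (hu : u ∈ e.target) :
    Function.Bijective (mfderiv (𝓡 n) (𝓡 n) e.symm u) :=
  (mdifferentiable_of_mem_maximalAtlas he).symm.mfderiv_bijective hu

namespace PseudoRiemannianMetric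

variable (g : PseudoRiemannianMetric n M)

theorem comp_symm (i j : Fin n) : g.comp e u i j = g.comp e u j i :=
  g.symm _ _ _

theorem contDiffOn_comp (he : e ∈ IsManifold.maximalAtlas (𝓡 n) ∞ M) (i j : Fin n) :
    ContDiffOn ℝ ∞ (fun u => g.comp e u i j) e.target :=
  g.smooth e he i j

theorem inv_symm (a b : Fin n) : g.inv e u a b = g.inv e u b a := by
  have hs : (Matrix.of (g.comp e u)).transpose = Matrix.of (g.comp e u) := by
    ext i j
    exact g.comp_symm j i
  unfold inv
  conv_lhs => rw [← hs, ← Matrix.transpose_nonsing_inv]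
  rfl

theorem christoffel_symm (c a b : Fin n) :
    g.christoffel e u c a b = g.christoffel e u c b a := by
  unfold christoffel
  refine congrArg _ (Finset.sum_congr rfl fun l _ => ?_)
  have : (fun v => g.comp e v a b) = fun v => g.comp e v b a := funext fun v => g.comp_symm a b
  rw [this]
  ring

/-- A kernel vector of the Gram matrix would be the coordinate vector of a tangent vector orthogonal
to everything, because the differential of the inverse chart is bijective. -/
theorem det_comp_ne_zero (he : e ∈ IsManifold.maximalAtlas (𝓡 n) ∞ M) (hu : u ∈ e.target) :
    (Matrix.of (g.comp e u)).det ≠ 0 := by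
  intro hdet
  obtain ⟨v, hv, hv0⟩ := Matrix.exists_vecMul_eq_zero_iff.2 hdet
  apply hv
  have hbij := mfderiv_symm_bijective he hu
  have h0 : mfderiv (𝓡 n) (𝓡 n) e.symm u (WithLp.toLp 2 v) = 0 := by
    apply g.nondegenerate
    intro w
    obtain ⟨w, rfl⟩ := hbij.2 w
    erw [mfderiv_symm_eq_sum, mfderiv_symm_eq_sum]
    have hv1 : ∀ j, ∑ i, v i * g.comp e u i j = 0 := fun j => by
      simpa [Matrix.vecMul, dotProduct] using congrFun hv0 j
    simp only [map_sum, map_smul, LinearMap.sum_apply, LinearMap.smul_apply]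
    refine Finset.sum_eq_zero fun j _ => ?_
    have := hv1 j
    unfold comp at this
    simp [this]
  have h1 := hbij.1 (h0.trans (map_zero (mfderiv (𝓡 n) (𝓡 n) e.symm u)).symm)
  funext i
  exact congrArg (fun x : EuclideanSpace ℝ (Fin n) => x i) h1

theorem sum_inv_mul_comp (he : e ∈ IsManifold.maximalAtlas (𝓡 n) ∞ M) (hu : u ∈ e.target)
    (a b : Fin n) : ∑ c, g.inv e u a c * g.comp e u c b = if a = b then 1 else 0 := by
  have h := congrFun (congrFun (Matrix.nonsing_inv_mul (Matrix.of (g.comp e u))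
    (isUnit_iff_ne_zero.2 (g.det_comp_ne_zero he hu))) a) b
  simpa [Matrix.mul_apply, Matrix.one_apply, inv] using h

/-- Cramer's rule: the adjugate and the determinant are polynomial in the `g_{ij}`, and the
determinant has no zero on the chart. -/
theorem contDiffOn_inv (he : e ∈ IsManifold.maximalAtlas (𝓡 n) ∞ M) (i j : Fin n) :
    ContDiffOn ℝ ∞ (fun u => g.inv e u i j) e.target := by
  have hdet : ∀ A : EuclideanSpace ℝ (Fin n) → Matrix (Fin n) (Fin n) ℝ,
      (∀ k l, ContDiffOn ℝ ∞ (fun u => A u k l) e.target) →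
      ContDiffOn ℝ ∞ (fun u => (A u).det) e.target := by
    intro A hA
    simp only [Matrix.det_apply']
    refine ContDiffOn.sum fun σ _ => contDiffOn_const.mul ?_
    exact contDiffOn_prod fun k _ => hA _ _
  have hadj : ContDiffOn ℝ ∞ (fun u => (Matrix.of (g.comp e u)).adjugate i j) e.target := by
    simp only [Matrix.adjugate_apply]
    refine hdet _ fun k l => ?_
    by_cases hk : k = j
    · subst hk
      simpa using contDiffOn_const
    · simpa [Matrix.updateRow_ne hk] using g.contDiffOn_comp he k l
  have := ((hdet (fun u => Matrix.of (g.comp e u)) (fun k l => g.contDiffOn_comp he k l)).inv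
    fun u hu => g.det_comp_ne_zero he hu).mul hadj
  refine this.congr fun u hu => ?_
  simp [inv, Matrix.inv_def, Ring.inverse_eq_inv']

theorem contDiffOn_christoffel (he : e ∈ IsManifold.maximalAtlas (𝓡 n) ∞ M) (c a b : Fin n) :
    ContDiffOn ℝ ∞ (fun u => g.christoffel e u c a b) e.target := by
  unfold christoffel
  refine contDiffOn_const.mul (ContDiffOn.sum fun l _ => (g.contDiffOn_inv he c l).mul ?_)
  have h := fun a i j => contDiffOn_pd e.open_target a (g.contDiffOn_comp he i j)
  exact ((h _ _ _).add (h _ _ _)).sub (h _ _ _)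

theorem sum_christoffel_mul_comp (he : e ∈ IsManifold.maximalAtlas (𝓡 n) ∞ M)
    (hu : u ∈ e.target) (a b d : Fin n) :
    ∑ c, g.christoffel e u c a b * g.comp e u c d = (1 / 2) *
      (pd a (fun v => g.comp e v b d) u + pd b (fun v => g.comp e v a d) u
        - pd d (fun v => g.comp e v a b) u) := by
  unfold christoffel
  simp only [mul_assoc, ← Finset.mul_sum, Finset.sum_mul]
  rw [Finset.sum_comm]
  congr 1
  have : ∀ l c, g.inv e u c l *
      ((pd a (fun v => g.comp e v b l) u + pd b (fun v => g.comp e v a l) u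
        - pd l (fun v => g.comp e v a b) u) * g.comp e u c d) =
      (g.inv e u l c * g.comp e u c d) * (pd a (fun v => g.comp e v b l) u +
        pd b (fun v => g.comp e v a l) u - pd l (fun v => g.comp e v a b) u) := by
    intro l c
    rw [g.inv_symm c l]
    ring
  simp only [this, ← Finset.sum_mul, g.sum_inv_mul_comp he hu]
  simp

/-- The Levi-Civita connection is compatible with the metric. -/
theorem pd_comp (he : e ∈ IsManifold.maximalAtlas (𝓡 n) ∞ M) (hu : u ∈ e.target)
    (c a b : Fin n) :
    pd c (fun v => g.comp e v a b) u =
      ∑ d, g.christoffel e u d c a * g.comp e u d b +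
        ∑ d, g.christoffel e u d c b * g.comp e u a d := by
  simp only [g.comp_symm a, g.sum_christoffel_mul_comp he hu]
  simp only [g.comp_symm b]
  ring

end PseudoRiemannianMetric

end Chart

/-! ### Multi-index algebra -/

/-- A permutation of `k + 1` slots is a choice of the index sent to the first slot together with a
permutation of the other `k`. Skewness of `h` makes the `k!` terms of each choice equal, leaving the
factor `1/(k+1)`. -/
theorem skewPart_mul {n k : ℕ} (w : Fin n → ℝ) (h : (Fin k → Fin n) → ℝ)
    (hh : ∀ (σ : Equiv.Perm (Fin k)) (b : Fin k → Fin n),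
      h (b ∘ σ) = ((Equiv.Perm.sign σ : ℤ) : ℝ) * h b) (b₁ : Fin n) (b : Fin k → Fin n) :
    skewPart (fun c : Fin (k + 1) → Fin n => w (c 0) * h (Fin.tail c)) (Fin.cons b₁ b) =
      (1 / ((k : ℝ) + 1)) *
        (w b₁ * h b - ∑ i : Fin k, w (b i) * h (Function.update b i b₁)) := by
  have hsq : ∀ σ : Equiv.Perm (Fin k),
      ((Equiv.Perm.sign σ : ℤ) : ℝ) * ((Equiv.Perm.sign σ : ℤ) : ℝ) = 1 := by
    intro σ
    rcases Int.units_eq_one_or (Equiv.Perm.sign σ) with h | h <;> simp [h]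
  have htail0 : ∀ σ : Equiv.Perm (Fin k),
      Fin.tail ((Fin.cons b₁ b : Fin (k + 1) → Fin n) ∘ Equiv.Perm.decomposeFin.symm (0, σ)) =
        b ∘ σ := by
    intro σ
    funext x
    simp [Fin.tail]
  have htail : ∀ (σ : Equiv.Perm (Fin k)) (i : Fin k),
      Fin.tail ((Fin.cons b₁ b : Fin (k + 1) → Fin n) ∘
        Equiv.Perm.decomposeFin.symm (i.succ, σ)) = Function.update b i b₁ ∘ σ := by
    intro σ i
    funext x
    simp only [Fin.tail, Function.comp_apply, Equiv.Perm.decomposeFin_symm_apply_succ]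
    by_cases hx : σ x = i
    · simp [hx]
    · rw [Equiv.swap_apply_of_ne_of_ne (Fin.succ_ne_zero _) (by simpa using hx)]
      simp [hx]
  unfold skewPart
  rw [← Equiv.sum_comp Equiv.Perm.decomposeFin.symm, Fintype.sum_prod_type, Fin.sum_univ_succ]
  simp only [htail0, htail, hh, Function.comp_apply, Equiv.Perm.decomposeFin_symm_apply_zero,
    Equiv.Perm.decomposeFin.symm_sign, Fin.cons_zero, Fin.cons_succ, if_true, Fin.succ_ne_zero,
    if_false]
  have e0 : ∀ σ : Equiv.Perm (Fin k), (((1 * Equiv.Perm.sign σ : ℤˣ) : ℤ) : ℝ) *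
      (w b₁ * (((Equiv.Perm.sign σ : ℤ) : ℝ) * h b)) = w b₁ * h b := by
    intro σ
    rw [one_mul]
    linear_combination (w b₁ * h b) * hsq σ
  have e1 : ∀ (i : Fin k) (σ : Equiv.Perm (Fin k)), (((-1 * Equiv.Perm.sign σ : ℤˣ) : ℤ) : ℝ) *
      (w (b i) * (((Equiv.Perm.sign σ : ℤ) : ℝ) * h (Function.update b i b₁))) =
        -(w (b i) * h (Function.update b i b₁)) := by
    intro i σ
    push_cast
    linear_combination (-(w (b i) * h (Function.update b i b₁))) * hsq σ
  simp only [e0, e1, Finset.sum_const, Finset.card_univ, Fintype.card_perm, Fintype.card_fin,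
    nsmul_eq_mul, ← Finset.mul_sum, Finset.sum_neg_distrib]
  have hk : (k.factorial : ℝ) ≠ 0 := by exact_mod_cast k.factorial_ne_zero
  have hk1 : (k : ℝ) + 1 ≠ 0 := by positivity
  rw [Nat.factorial_succ]
  push_cast
  field_simp
  ring

/-- The commutator of the actions of two endomorphisms on a covariant tensor. -/
theorem sum_update_commutator {n k : ℕ} (A A' : Fin n → Fin n → ℝ) (T : (Fin k → Fin n) → ℝ)
    (B : Fin k → Fin n) :
    ∑ j, ∑ c, A c (B j) * ∑ i, ∑ d, A' d (Function.update B j c i) *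
        T (Function.update (Function.update B j c) i d) -
      ∑ j, ∑ c, A' c (B j) * ∑ i, ∑ d, A d (Function.update B j c i) *
        T (Function.update (Function.update B j c) i d) =
      ∑ j, ∑ d, (∑ c, (A c (B j) * A' d c - A' c (B j) * A d c)) * T (Function.update B j d) := by
  let q : (Fin n → Fin n → ℝ) → (Fin n → Fin n → ℝ) → Fin k → Fin k → ℝ := fun A A' j i =>
    ∑ c, ∑ d, A c (B j) * (A' d (Function.update B j c i) *
      T (Function.update (Function.update B j c) i d))
  have hQ : ∀ A A' : Fin n → Fin n → ℝ,
      ∑ j, ∑ c, A c (B j) * ∑ i, ∑ d, A' d (Function.update B j c i) *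
        T (Function.update (Function.update B j c) i d) = ∑ j, ∑ i, q A A' j i := by
    intro A A'
    refine Finset.sum_congr rfl fun j _ => ?_
    simp only [Finset.mul_sum]
    rw [Finset.sum_comm]
  -- Endomorphisms acting in different slots commute, so only the diagonal terms `i = j` contribute
  -- to the commutator.
  have hne : ∀ i j, i ≠ j → q A A' j i = q A' A i j := by
    intro i j hij
    simp only [q]
    rw [Finset.sum_comm]
    refine Finset.sum_congr rfl fun d _ => Finset.sum_congr rfl fun c _ => ?_
    rw [Function.update_of_ne hij, Function.update_of_ne hij.symm, Function.update_comm hij]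
    ring
  rw [hQ, hQ, Finset.sum_comm (f := fun j i => q A' A j i), ← Finset.sum_sub_distrib]
  refine Finset.sum_congr rfl fun j _ => ?_
  rw [← Finset.sum_sub_distrib, Finset.sum_eq_single j
    (fun i _ hij => by rw [hne i j hij, sub_self]) (by simp)]
  simp only [q, Function.update_self, Function.update_idem]
  rw [Finset.sum_comm, Finset.sum_comm (f := fun c d => A' c (B j) * _),
    ← Finset.sum_sub_distrib]
  refine Finset.sum_congr rfl fun d _ => ?_
  rw [← Finset.sum_sub_distrib, Finset.sum_mul]
  refine Finset.sum_congr rfl fun c _ => ?_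
  ring

/-! ### Covariant derivatives of tensors -/

namespace PseudoRiemannianMetric

variable {n : ℕ} {M : Type*} [TopologicalSpace M] [ChartedSpace (EuclideanSpace ℝ (Fin n)) M]
  {e : OpenPartialHomeomorph M (EuclideanSpace ℝ (Fin n))} {u : EuclideanSpace ℝ (Fin n)}
  (g : PseudoRiemannianMetric n M)
  {k : ℕ} {T T₁ T₂ : EuclideanSpace ℝ (Fin n) → (Fin k → Fin n) → ℝ}

theorem nabla_congr (hu : u ∈ e.target) (h : ∀ v ∈ e.target, ∀ b, T₁ v b = T₂ v b)
    (a : Fin n) (b : Fin k → Fin n) : g.nabla e T₁ u a b = g.nabla e T₂ u a b := by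
  unfold nabla
  rw [pd_congr a e.open_target hu fun v hv => h v hv b]
  simp only [h u hu]

theorem nabla_zero (a : Fin n) (b : Fin k → Fin n) : g.nabla e (fun _ _ => 0) u a b = 0 := by
  simp [nabla, pd_zero]

theorem nabla_add (h₁ : ∀ b, DifferentiableAt ℝ (fun v => T₁ v b) u)
    (h₂ : ∀ b, DifferentiableAt ℝ (fun v => T₂ v b) u) (a : Fin n) (b : Fin k → Fin n) :
    g.nabla e (fun v b => T₁ v b + T₂ v b) u a b =
      g.nabla e T₁ u a b + g.nabla e T₂ u a b := by
  simp only [nabla, pd_add a (h₁ b) (h₂ b), mul_add, Finset.sum_add_distrib]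
  ring

theorem nabla_const_mul (r : ℝ) (h : ∀ b, DifferentiableAt ℝ (fun v => T v b) u) (a : Fin n)
    (b : Fin k → Fin n) :
    g.nabla e (fun v b => r * T v b) u a b = r * g.nabla e T u a b := by
  simp only [nabla, pd_const_mul a r (h b), mul_sub, Finset.mul_sum, mul_left_comm]

theorem nabla_sum {ι : Type*} (t : Finset ι)
    {F : ι → EuclideanSpace ℝ (Fin n) → (Fin k → Fin n) → ℝ}
    (h : ∀ i b, DifferentiableAt ℝ (fun v => F i v b) u) (a : Fin n) (b : Fin k → Fin n) :
    g.nabla e (fun v b => ∑ i ∈ t, F i v b) u a b = ∑ i ∈ t, g.nabla e (F i) u a b := by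
  classical
  induction t using Finset.induction_on with
  | empty => simp [nabla_zero]
  | insert i t hi ih =>
    simp only [Finset.sum_insert hi]
    rw [nabla_add g (h i) (fun b => DifferentiableAt.fun_sum fun j _ => h j b), ih]

/-- All slots carry the same Christoffel correction, so `∇` commutes with permuting them. Identities
between permuted tensors can therefore be differentiated term by term. -/
theorem nabla_comp_perm (σ : Equiv.Perm (Fin k)) (a : Fin n) (b : Fin k → Fin n) :
    g.nabla e (fun v b => T v (b ∘ σ)) u a b = g.nabla e T u a (b ∘ σ) := by
  unfold nabla
  congr 1
  rw [← Equiv.sum_comp σ]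
  refine Finset.sum_congr rfl fun j _ => Finset.sum_congr rfl fun c _ => ?_
  have : Function.update b (σ j) c ∘ σ = Function.update (b ∘ σ) j c := by
    rw [Function.update_comp_eq_of_injective _ σ.injective]
  simp only [this, Function.comp_apply]

theorem contDiffOn_nabla (he : e ∈ IsManifold.maximalAtlas (𝓡 n) ∞ M)
    (h : ∀ b, ContDiffOn ℝ ∞ (fun v => T v b) e.target) (a : Fin n) (b : Fin k → Fin n) :
    ContDiffOn ℝ ∞ (fun v => g.nabla e T v a b) e.target := by
  unfold nabla
  exact (contDiffOn_pd e.open_target a (h b)).sub (ContDiffOn.sum fun j _ =>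
    ContDiffOn.sum fun c _ => (g.contDiffOn_christoffel he c a (b j)).mul (h _))

/-- The covariant derivative of a tensor product `g ⊗ T` is `g ⊗ ∇T`. -/
theorem nabla_comp_mul (he : e ∈ IsManifold.maximalAtlas (𝓡 n) ∞ M) (hu : u ∈ e.target)
    (h : ∀ b, DifferentiableAt ℝ (fun v => T v b) u) (a : Fin n) (b : Fin (k + 2) → Fin n) :
    g.nabla e (fun v (b : Fin (k + 2) → Fin n) =>
        g.comp e v (b 0) (b 1) * T v (Fin.tail (Fin.tail b))) u a b =
      g.comp e u (b 0) (b 1) * g.nabla e T u a (Fin.tail (Fin.tail b)) := by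
  obtain ⟨x, b, rfl⟩ : ∃ x b', b = Fin.cons x b' := ⟨b 0, Fin.tail b, (Fin.cons_self_tail b).symm⟩
  obtain ⟨y, b, rfl⟩ : ∃ x b', b = Fin.cons x b' := ⟨b 0, Fin.tail b, (Fin.cons_self_tail b).symm⟩
  unfold nabla
  rw [pd_mul a (differentiableAt_of_contDiffOn e.open_target hu (g.contDiffOn_comp he _ _)) (h _),
    g.pd_comp he hu, Fin.sum_univ_succ, Fin.sum_univ_succ]
  simp only [Fin.cons_zero, Fin.cons_one, Fin.tail_cons, Fin.update_cons_zero, Fin.cons_succ,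
    ← Fin.cons_update, mul_sub, Finset.mul_sum, add_mul, Finset.sum_mul]
  simp only [mul_assoc, mul_left_comm]
  ring

theorem nabla_comp (he : e ∈ IsManifold.maximalAtlas (𝓡 n) ∞ M) (hu : u ∈ e.target)
    (a : Fin n) (b : Fin 2 → Fin n) :
    g.nabla e (fun v (b : Fin 2 → Fin n) => g.comp e v (b 0) (b 1)) u a b = 0 := by
  -- The metric is its own tensor product with the constant 1 of rank 0.
  have h1 := g.nabla_comp_mul he hu (T := fun _ (_ : Fin 0 → Fin n) => 1)
    (fun _ => differentiableAt_const _) a b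
  simp only [mul_one] at h1
  rw [h1]
  simp [nabla, pd]

/-- The Ricci identity. -/
theorem nabla_nabla_sub (he : e ∈ IsManifold.maximalAtlas (𝓡 n) ∞ M) (hu : u ∈ e.target)
    (h : ∀ b, ContDiffOn ℝ ∞ (fun v => T v b) e.target) (a b : Fin n) (B : Fin k → Fin n) :
    g.nabla e (fun v (I : Fin (k + 1) → Fin n) => g.nabla e T v (I 0) (Fin.tail I)) u a
        (Fin.cons b B) -
      g.nabla e (fun v (I : Fin (k + 1) → Fin n) => g.nabla e T v (I 0) (Fin.tail I)) u b
        (Fin.cons a B) =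
      ∑ j, ∑ d, g.riemannUp e u a b (B j) d * T u (Function.update B j d) := by
  have hΓ := fun c a b => differentiableAt_of_contDiffOn e.open_target hu
    (g.contDiffOn_christoffel he c a b)
  have hT := fun b => differentiableAt_of_contDiffOn e.open_target hu (h b)
  have hpT := fun a b => differentiableAt_of_contDiffOn e.open_target hu
    (contDiffOn_pd e.open_target a (h b))
  -- In this expansion the two `Γ ∂T` sums are exchanged by `a ↔ b`, while `∂∂T` and the `Γ^c_{ab}
  -- ∇_c T` term are symmetric. Only the `∂Γ` terms and the commutator of the connection matrices
  -- survive.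
  have key : ∀ a b : Fin n,
      g.nabla e (fun v (I : Fin (k + 1) → Fin n) => g.nabla e T v (I 0) (Fin.tail I)) u a
        (Fin.cons b B) = pd a (pd b fun v => T v B) u
        - ∑ j, ∑ c, (pd a (fun v => g.christoffel e v c b (B j)) u * T u (Function.update B j c))
        - ∑ j, ∑ c, (g.christoffel e u c b (B j) * pd a (fun v => T v (Function.update B j c)) u)
        - ∑ c, g.christoffel e u c a b * g.nabla e T u c B
        - ∑ j, ∑ c, g.christoffel e u c a (B j) * pd b (fun v => T v (Function.update B j c)) u
        + ∑ j, ∑ c, g.christoffel e u c a (B j) * ∑ i, ∑ d,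
            g.christoffel e u d b (Function.update B j c i) *
              T u (Function.update (Function.update B j c) i d) := by
    intro a b
    have h1 : pd a (fun v => g.nabla e T v b B) u = pd a (pd b fun v => T v B) u
        - (∑ j, ∑ c, (pd a (fun v => g.christoffel e v c b (B j)) u * T u (Function.update B j c))
        + ∑ j, ∑ c, (g.christoffel e u c b (B j) *
          pd a (fun v => T v (Function.update B j c)) u)) := by
      unfold nabla
      rw [pd_sub a (hpT b B) (DifferentiableAt.fun_sum fun j _ => DifferentiableAt.fun_sum
        fun c _ => (hΓ c b (B j)).fun_mul (hT _)),
        pd_sum a _ (fun j _ => DifferentiableAt.fun_sum fun c _ => (hΓ c b (B j)).fun_mul (hT _))]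
      simp only [pd_sum a _ (fun c _ => (hΓ c b (B _)).fun_mul (hT _)),
        fun c j => pd_mul a (hΓ c b (B j)) (hT (Function.update B j c)), Finset.sum_add_distrib]
    conv_lhs => rw [nabla]
    simp only [Fin.sum_univ_succ, Fin.cons_zero, Fin.tail_cons, Fin.cons_succ,
      Fin.update_cons_zero, ← Fin.cons_update]
    have h2 : ∀ j c, g.christoffel e u c a (B j) * g.nabla e T u b (Function.update B j c) =
        g.christoffel e u c a (B j) * pd b (fun v => T v (Function.update B j c)) u -
        g.christoffel e u c a (B j) * ∑ i, ∑ d,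
            g.christoffel e u d b (Function.update B j c i) *
              T u (Function.update (Function.update B j c) i d) := by
      intro j c
      rw [← mul_sub]
      rfl
    simp only [h2, Finset.sum_sub_distrib]
    rw [h1]
    ring
  have hcomm := sum_update_commutator (fun c x => g.christoffel e u c a x)
    (fun c x => g.christoffel e u c b x) (T u) B
  have hs : ∑ c, g.christoffel e u c a b * g.nabla e T u c B =
      ∑ c, g.christoffel e u c b a * g.nabla e T u c B :=
    Finset.sum_congr rfl fun c _ => by rw [g.christoffel_symm]
  have hR : ∑ j, ∑ d, g.riemannUp e u a b (B j) d * T u (Function.update B j d) =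
      ∑ j, ∑ c, (pd b (fun v => g.christoffel e v c a (B j)) u * T u (Function.update B j c))
      - ∑ j, ∑ c, (pd a (fun v => g.christoffel e v c b (B j)) u * T u (Function.update B j c))
      + ∑ j, ∑ d, (∑ c, (g.christoffel e u c a (B j) * g.christoffel e u d b c -
        g.christoffel e u c b (B j) * g.christoffel e u d a c)) *
          T u (Function.update B j d) := by
    simp only [riemannUp, add_mul, sub_mul, Finset.sum_add_distrib, Finset.sum_sub_distrib]
  rw [key a b, key b a, hR, ← hcomm, pd_comm e.open_target hu (h B) a b, hs]
  ring

end PseudoRiemannianMetric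

/-! ### Symmetries of the curvature -/

namespace PseudoRiemannianMetric

variable {n : ℕ} {M : Type*} [TopologicalSpace M] [ChartedSpace (EuclideanSpace ℝ (Fin n)) M]
  {e : OpenPartialHomeomorph M (EuclideanSpace ℝ (Fin n))} {u : EuclideanSpace ℝ (Fin n)}
  (g : PseudoRiemannianMetric n M)

theorem riemannUp_swap_left (a b c d : Fin n) :
    g.riemannUp e u a b c d = -g.riemannUp e u b a c d := by
  simp only [riemannUp, Finset.sum_sub_distrib]
  ring

theorem riemann_swap_left (a b c d : Fin n) :
    g.riemann e u a b c d = -g.riemann e u b a c d := by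
  simp only [riemann, g.riemannUp_swap_left a b, mul_neg, Finset.sum_neg_distrib]

/-- Absence of torsion: symmetry of `Γ` in its lower indices makes the terms of the cyclic sum
cancel in pairs. -/
theorem riemannUp_bianchi (a b c d : Fin n) :
    g.riemannUp e u a b c d + g.riemannUp e u b c a d + g.riemannUp e u c a b d = 0 := by
  have h : ∀ x y : Fin n, (fun v => g.christoffel e v d x y) = fun v => g.christoffel e v d y x :=
    fun x y => funext fun v => g.christoffel_symm d x y
  simp only [riemannUp, Finset.sum_sub_distrib, h a b, h a c, h b c,
    fun f => g.christoffel_symm (e := e) (u := u) f a b,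
    fun f => g.christoffel_symm (e := e) (u := u) f a c,
    fun f => g.christoffel_symm (e := e) (u := u) f b c]
  ring

theorem riemann_bianchi (a b c d : Fin n) :
    g.riemann e u a b c d + g.riemann e u b c a d + g.riemann e u c a b d = 0 := by
  simp only [riemann, ← Finset.sum_add_distrib, ← mul_add, riemannUp_bianchi, mul_zero,
    Finset.sum_const_zero]

/-- This is the Ricci identity applied to the metric itself, whose left-hand side is zero because
`∇g = 0`. -/
theorem riemann_swap_right (he : e ∈ IsManifold.maximalAtlas (𝓡 n) ∞ M) (hu : u ∈ e.target)
    (a b c d : Fin n) : g.riemann e u a b c d = -g.riemann e u a b d c := by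
  have h := g.nabla_nabla_sub he hu (T := fun v (b : Fin 2 → Fin n) => g.comp e v (b 0) (b 1))
    (fun _ => g.contDiffOn_comp he _ _) a b ![c, d]
  have h0 : ∀ x (I : Fin 3 → Fin n), g.nabla e (fun v (I : Fin 3 → Fin n) =>
      g.nabla e (fun v (b : Fin 2 → Fin n) => g.comp e v (b 0) (b 1)) v (I 0) (Fin.tail I)) u x I
      = 0 := by
    intro x I
    rw [g.nabla_congr hu (T₂ := fun _ _ => 0) (fun v hv b => g.nabla_comp he hv _ _), nabla_zero]
  rw [h0, h0, Fin.sum_univ_two] at h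
  simp only [Function.update_self, ne_eq, Fin.one_eq_zero_iff, Fin.zero_eq_one_iff,
    Function.update_of_ne, Matrix.cons_val_zero, Matrix.cons_val_one, OfNat.ofNat_ne_one,
    not_false_eq_true] at h
  simp only [riemann]
  have e1 : ∀ x, g.comp e u d x * g.riemannUp e u a b c x =
      g.riemannUp e u a b c x * g.comp e u x d := fun x => by rw [g.comp_symm]; ring
  have e2 : ∀ x, g.comp e u c x * g.riemannUp e u a b d x =
      g.riemannUp e u a b d x * g.comp e u c x := fun x => by ring
  simp only [e1, e2]
  linarith

/-- The classical combination of four Bianchi identities with skewness in each pair. -/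
theorem riemann_pair_symm (he : e ∈ IsManifold.maximalAtlas (𝓡 n) ∞ M) (hu : u ∈ e.target)
    (a b c d : Fin n) : g.riemann e u a b c d = g.riemann e u c d a b := by
  have L := fun a b c d => g.riemann_swap_left (e := e) (u := u) a b c d
  have R := g.riemann_swap_right he hu
  have h1 := g.riemann_bianchi (e := e) (u := u) a b c d
  have h2 := g.riemann_bianchi (e := e) (u := u) b c d a
  have h3 := g.riemann_bianchi (e := e) (u := u) c d a b
  have h4 := g.riemann_bianchi (e := e) (u := u) d a b c
  linarith [R a b c d, R b c a d, R c a b d, R b c d a, R c d b a, R d b c a, R c d a b,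
    R d a c b, R a c d b, L a c b d, L a c d b, L d b a c, L d b c a, R c a d b, R d b a c,
    R d a b c]

theorem riemannUp_eq (he : e ∈ IsManifold.maximalAtlas (𝓡 n) ∞ M) (hu : u ∈ e.target)
    (a b c f : Fin n) :
    g.riemannUp e u a b c f = ∑ d, g.inv e u f d * g.riemann e u a b c d := by
  simp only [riemann, Finset.mul_sum]
  rw [Finset.sum_comm]
  simp only [← mul_assoc, ← Finset.sum_mul, g.sum_inv_mul_comp he hu]
  simp

/-- On an Einstein space the Weyl tensor differs from the Riemann tensor by a multiple of
`g_{ac} g_{bd} - g_{ad} g_{bc}`. -/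
theorem weyl_eq_of_ricci {Λ : ℝ} (hΛ : ∀ a b, g.ricci e u a b = Λ * g.comp e u a b) :
    ∃ κ : ℝ, ∀ a b c d, g.weyl e u a b c d = g.riemann e u a b c d +
      κ * (g.comp e u a c * g.comp e u b d - g.comp e u a d * g.comp e u b c) := by
  refine ⟨-2 * Λ / ((n : ℝ) - 2) + g.scalarCurv e u / (((n : ℝ) - 1) * ((n : ℝ) - 2)),
    fun a b c d => ?_⟩
  simp only [weyl, hΛ]
  ring

/-- The contraction is minus the Ricci tensor with an index raised, which the Einstein condition
makes a multiple of the identity. -/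
theorem sum_inv_mul_riemannUp (he : e ∈ IsManifold.maximalAtlas (𝓡 n) ∞ M) (hu : u ∈ e.target)
    {Λ : ℝ} (hΛ : ∀ a b, g.ricci e u a b = Λ * g.comp e u a b) (c f : Fin n) :
    ∑ a, ∑ b, g.inv e u a b * g.riemannUp e u c a b f = if f = c then -Λ else 0 := by
  have h1 : ∀ s, ∑ a, ∑ b, g.inv e u a b * g.riemann e u c a b s = -(Λ * g.comp e u s c) := by
    intro s
    rw [g.comp_symm, ← hΛ, ricci, Finset.sum_comm, ← Finset.sum_neg_distrib]
    refine Finset.sum_congr rfl fun b _ => ?_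
    rw [← Finset.sum_neg_distrib]
    refine Finset.sum_congr rfl fun a _ => ?_
    rw [g.riemann_swap_left, g.inv_symm]
    ring
  have h2 : ∑ a, ∑ b, g.inv e u a b * g.riemannUp e u c a b f =
      ∑ s, g.inv e u f s * ∑ a, ∑ b, g.inv e u a b * g.riemann e u c a b s := by
    simp only [g.riemannUp_eq he hu, Finset.mul_sum]
    rw [Finset.sum_comm_cycle]
    exact Finset.sum_congr rfl fun s _ => Finset.sum_congr rfl fun a _ =>
      Finset.sum_congr rfl fun b _ => mul_left_comm _ _ _
  rw [h2]
  simp only [h1, mul_neg, Finset.sum_neg_distrib, mul_left_comm _ Λ, ← Finset.mul_sum,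
    g.sum_inv_mul_comp he hu]
  split_ifs <;> simp [*]

end PseudoRiemannianMetric

/-! ### Contractions with an inverse metric -/

/-- The full contraction `γ^{ab} γ^{fs} F_{as} Z_{bf}`. -/
def contract {n : ℕ} (γ F Z : Fin n → Fin n → ℝ) : ℝ :=
  ∑ a, ∑ b, ∑ f, ∑ s, γ a b * γ f s * F a s * Z b f

section Contract

variable {n : ℕ} {γ Z : Fin n → Fin n → ℝ}

/-- Reversing the order of the four summation indices transposes `F` and `Z` simultaneously, and
transposing `Z` costs a sign. -/
theorem contract_swap (hγ : ∀ a b, γ a b = γ b a) (hZ : ∀ a b, Z a b = -Z b a)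
    (F : Fin n → Fin n → ℝ) : contract γ (fun a b => F b a) Z = -contract γ F Z := by
  unfold contract
  have h1 : ∀ F : Fin n → Fin n → Fin n → Fin n → ℝ,
      ∑ a, ∑ b, ∑ f, ∑ s, F a b f s = ∑ x : Fin n × Fin n × Fin n × Fin n,
        F x.1 x.2.1 x.2.2.1 x.2.2.2 := by
    intro F
    simp only [Fintype.sum_prod_type]
  rw [h1, h1, ← Finset.sum_neg_distrib]
  refine Fintype.sum_equiv ⟨fun x => (x.2.2.2, x.2.2.1, x.2.1, x.1),
    fun x => (x.2.2.2, x.2.2.1, x.2.1, x.1), fun _ => rfl, fun _ => rfl⟩ _ _ fun x => ?_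
  simp only [Equiv.coe_fn_mk]
  rw [hZ x.2.1, hγ x.1, hγ x.2.2.1]
  ring

theorem contract_linear (F F' : Fin n → Fin n → ℝ) (r r' : ℝ) :
    contract γ (fun a b => r * F a b + r' * F' a b) Z =
      r * contract γ F Z + r' * contract γ F' Z := by
  simp only [contract, Finset.mul_sum, ← Finset.sum_add_distrib]
  exact Finset.sum_congr rfl fun a _ => Finset.sum_congr rfl fun b _ => Finset.sum_congr rfl
    fun f _ => Finset.sum_congr rfl fun s _ => by ring

theorem contract_mul_self {m : Fin n → Fin n → ℝ}
    (hγm : ∀ a b, ∑ c, γ a c * m c b = if a = b then 1 else 0)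
    (hγ : ∀ a b, γ a b = γ b a) (x y : Fin n) :
    contract γ (fun a b => m a x * m b y) Z = Z x y := by
  have h1 : contract γ (fun a b => m a x * m b y) Z =
      ∑ b, ∑ f, (∑ a, γ b a * m a x) * (∑ s, γ f s * m s y) * Z b f := by
    unfold contract
    rw [Finset.sum_comm]
    refine Finset.sum_congr rfl fun b _ => ?_
    rw [Finset.sum_comm]
    refine Finset.sum_congr rfl fun f _ => ?_
    rw [Finset.sum_mul_sum, Finset.sum_mul]
    simp only [Finset.sum_mul]
    refine Finset.sum_congr rfl fun a _ => Finset.sum_congr rfl fun s _ => ?_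
    rw [hγ a b]
    ring
  rw [h1]
  simp [hγm]

end Contract

/-! ### The right-hand side of the conformal Killing-Yano equation -/

/-- The tensor `2 m_{ab} H_B - ∑_i (m_{a b_i} H_{B[i → b]} + m_{b b_i} H_{B[i → a]})`, a multiple of
`m_{a[b} H_{B]} + m_{b[a} H_{B]}` for skew-symmetric `H`. -/
def traceTerm {n k : ℕ} (m : Fin n → Fin n → ℝ) (H : (Fin k → Fin n) → ℝ) (a b : Fin n)
    (B : Fin k → Fin n) : ℝ :=
  2 * (m a b * H B) - ∑ i, (m a (B i) * H (Function.update B i b) +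
    m b (B i) * H (Function.update B i a))

section TraceTerm

variable {n : ℕ} {γ m : Fin n → Fin n → ℝ}

theorem sum_mul_traceTerm {k : ℕ} (hm : ∀ a b, m a b = m b a) (hγ : ∀ a b, γ a b = γ b a)
    (hγm : ∀ a b, ∑ c, γ a c * m c b = if a = b then 1 else 0)
    (H : (Fin k → Fin n) → ℝ) (B : Fin k → Fin n) :
    ∑ a, ∑ b, γ a b * traceTerm m H a b B = 2 * ((n : ℝ) - k) * H B := by
  have h1 : ∑ a, ∑ b, γ a b * m a b = n := by
    have : ∀ a b, γ a b * m a b = γ a b * m b a := fun a b => by rw [hm]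
    rw [Finset.sum_congr rfl fun a _ => Finset.sum_congr rfl fun b _ => this a b]
    simp [hγm]
  have h2 : ∀ i, ∑ a, ∑ b, γ a b * (m a (B i) * H (Function.update B i b)) = H B := by
    intro i
    rw [Finset.sum_comm]
    have : ∀ a b, γ a b * (m a (B i) * H (Function.update B i b)) =
      (γ b a * m a (B i)) * H (Function.update B i b) := fun a b => by rw [hγ]; ring
    simp only [this, ← Finset.sum_mul, hγm]
    simp
  have h3 : ∀ i, ∑ a, ∑ b, γ a b * (m b (B i) * H (Function.update B i a)) = H B := by
    intro i
    simp only [← mul_assoc, ← Finset.sum_mul, hγm]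
    simp
  have h4 : ∑ a, ∑ b, γ a b * (2 * (m a b * H B)) = 2 * n * H B := by
    rw [← h1]
    simp only [Finset.mul_sum, Finset.sum_mul]
    exact Finset.sum_congr rfl fun a _ => Finset.sum_congr rfl fun b _ => by ring
  have h5 : ∑ a, ∑ b, γ a b * ∑ i, (m a (B i) * H (Function.update B i b) +
      m b (B i) * H (Function.update B i a)) = 2 * k * H B := by
    simp only [Finset.mul_sum, mul_add]
    rw [Finset.sum_comm_cycle]
    simp only [Finset.sum_add_distrib, h2, h3]
    simp
    ring
  simp only [traceTerm, mul_sub, Finset.sum_sub_distrib, h4, h5]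
  ring

/-- The trace of the commutator of second covariant derivatives of a conformal Killing-Yano tensor,
symmetrized in two indices. -/
theorem sum_mul_sub_add_sum_mul_sub {q : ℕ} {r : ℝ}
    (hm : ∀ a b, m a b = m b a) (hγ : ∀ a b, γ a b = γ b a)
    (hγm : ∀ a b, ∑ c, γ a c * m c b = if a = b then 1 else 0)
    {N : Fin n → Fin n → (Fin (q + 2) → Fin n) → ℝ} {H : Fin n → (Fin (q + 1) → Fin n) → ℝ}
    (hN : ∀ c a b B, N c a (Fin.cons b B) + N c b (Fin.cons a B) = r * traceTerm m (H c) a b B)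
    (hskew : ∀ c a b d (E : Fin q → Fin n), N c a (Fin.cons b (Fin.cons d E)) =
      -N c a (Fin.cons d (Fin.cons b E))) (c d : Fin n) (E : Fin q → Fin n) :
    ∑ a, ∑ b, γ a b * (N c a (Fin.cons b (Fin.cons d E)) - N a c (Fin.cons b (Fin.cons d E))) +
      ∑ a, ∑ b, γ a b * (N d a (Fin.cons b (Fin.cons c E)) - N a d (Fin.cons b (Fin.cons c E))) =
    r * (((n : ℝ) - q - 2) * (H c (Fin.cons d E) + H d (Fin.cons c E)) +
      traceTerm m (fun E => ∑ a, ∑ b, γ a b * H a (Fin.cons b E)) c d E) := by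
  -- Trace of `hN` over `a, b`: since `γ` is symmetric, the two terms on the left have equal traces.
  have h1 : ∀ c (B : Fin (q + 1) → Fin n),
      ∑ a, ∑ b, γ a b * N c a (Fin.cons b B) = r * (((n : ℝ) - q - 1) * H c B) := by
    intro c B
    have e1 : ∑ a, ∑ b, γ a b * (N c a (Fin.cons b B) + N c b (Fin.cons a B)) =
        r * (2 * ((n : ℝ) - (q + 1 : ℕ)) * H c B) := by
      rw [← sum_mul_traceTerm hm hγ hγm (H c) B, Finset.mul_sum]
      refine Finset.sum_congr rfl fun a _ => ?_
      rw [Finset.mul_sum]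
      exact Finset.sum_congr rfl fun b _ => by rw [hN]; ring
    have e2 : ∑ a, ∑ b, γ a b * N c b (Fin.cons a B) = ∑ a, ∑ b, γ a b * N c a (Fin.cons b B) := by
      rw [Finset.sum_comm]
      exact Finset.sum_congr rfl fun a _ => Finset.sum_congr rfl fun b _ => by rw [hγ]
    simp only [mul_add, Finset.sum_add_distrib, e2] at e1
    push_cast at e1
    linear_combination e1 / 2
  -- Skewness moves the contracted index `b` behind `d`, so that `hN` applies to the pair `c, d`.
  have h2 : ∑ a, ∑ b, γ a b * N a c (Fin.cons b (Fin.cons d E)) +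
      ∑ a, ∑ b, γ a b * N a d (Fin.cons b (Fin.cons c E)) =
      -(r * ∑ a, ∑ b, γ a b * traceTerm m (H a) c d (Fin.cons b E)) := by
    simp only [Finset.mul_sum, ← Finset.sum_add_distrib, ← Finset.sum_neg_distrib]
    refine Finset.sum_congr rfl fun a _ => Finset.sum_congr rfl fun b _ => ?_
    linear_combination γ a b * hskew a c b d E + γ a b * hskew a d b c E -
      γ a b * hN a c d (Fin.cons b E)
  -- The slot holding `b` is contracted through `m` and gives back `H` itself; this lowers the
  -- coefficient `n - q - 1` of `h1` to `n - q - 2`. In the other terms the contraction passes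
  -- through to the divergence.
  have h3 : ∑ a, ∑ b, γ a b * traceTerm m (H a) c d (Fin.cons b E) =
      traceTerm m (fun E => ∑ a, ∑ b, γ a b * H a (Fin.cons b E)) c d E -
        (H c (Fin.cons d E) + H d (Fin.cons c E)) := by
    have e1 : ∀ x y, ∑ a, ∑ b, γ a b * (m x b * H a (Fin.cons y E)) = H x (Fin.cons y E) := by
      intro x y
      have : ∀ a b, γ a b * (m x b * H a (Fin.cons y E)) =
        (γ a b * m b x) * H a (Fin.cons y E) := fun a b => by rw [hm]; ring
      simp only [this, ← Finset.sum_mul, hγm]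
      simp
    have e2 : ∀ (z : ℝ) (B : Fin q → Fin n), ∑ a, ∑ b, γ a b * (z * H a (Fin.cons b B)) =
        z * ∑ a, ∑ b, γ a b * H a (Fin.cons b B) := by
      intro z B
      simp only [Finset.mul_sum, mul_left_comm]
    have e3 : ∑ a, ∑ b, γ a b * ∑ i, (m c (E i) * H a (Fin.cons b (Function.update E i d)) +
          m d (E i) * H a (Fin.cons b (Function.update E i c))) =
        ∑ i, (m c (E i) * ∑ a, ∑ b, γ a b * H a (Fin.cons b (Function.update E i d)) +
          m d (E i) * ∑ a, ∑ b, γ a b * H a (Fin.cons b (Function.update E i c))) := by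
      simp only [← e2, ← Finset.sum_add_distrib]
      simp only [Finset.mul_sum, mul_add]
      rw [Finset.sum_comm_cycle]
    simp only [traceTerm, Fin.sum_univ_succ, Fin.cons_zero, Fin.cons_succ, Fin.update_cons_zero,
      ← Fin.cons_update, mul_sub, mul_add, Finset.sum_sub_distrib, Finset.sum_add_distrib, e1]
    rw [← Finset.sum_add_distrib, ← e3, ← e2]
    simp only [Finset.mul_sum, mul_add, Finset.sum_add_distrib]
    simp only [mul_left_comm (2 : ℝ)]
    ring
  have h4 := h1 c (Fin.cons d E)
  have h5 := h1 d (Fin.cons c E)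
  simp only [mul_sub, Finset.sum_sub_distrib]
  rw [h3] at h2
  linear_combination h4 + h5 - h2

end TraceTerm

/-! ### The curvature term -/

/-- A function of multi-indices that changes sign according to the sign of a permutation. -/
def IsSkew {n k : ℕ} (T : (Fin k → Fin n) → ℝ) : Prop :=
  ∀ (σ : Equiv.Perm (Fin k)) (b : Fin k → Fin n), T (b ∘ σ) = ((Equiv.Perm.sign σ : ℤ) : ℝ) * T b

theorem IsSkew.swap {n k : ℕ} {T : (Fin k → Fin n) → ℝ} (hT : IsSkew T) {i j : Fin k}
    (hij : i ≠ j) (b : Fin k → Fin n) : T (b ∘ Equiv.swap i j) = -T b := by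
  rw [hT, Equiv.Perm.sign_swap hij]
  simp

/-! ### Transpositions of multi-indices -/

section MultiIndex

variable {n k : ℕ} (a b : Fin n) (B : Fin k → Fin n) (i : Fin k)

theorem cons_cons_comp_swap_zero_one :
    (Fin.cons a (Fin.cons b B) : Fin (k + 2) → Fin n) ∘ Equiv.swap 0 1 =
      Fin.cons b (Fin.cons a B) := by
  funext x
  refine Fin.cases ?_ (fun x => Fin.cases ?_ (fun x => ?_) x) x
  · simp
  · simp
  · simp only [Function.comp_apply]
    rw [Equiv.swap_apply_of_ne_of_ne (Fin.succ_ne_zero _) (by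
      rw [← Fin.succ_zero_eq_one]; exact fun h => Fin.succ_ne_zero _ (Fin.succ_injective _ h))]
    simp

theorem cons_comp_swap_zero_succ :
    (Fin.cons a B : Fin (k + 1) → Fin n) ∘ Equiv.swap 0 i.succ =
      Fin.cons (B i) (Function.update B i a) := by
  funext x
  refine Fin.cases ?_ (fun x => ?_) x
  · simp
  · by_cases hx : x = i
    · simp [hx]
    · simp only [Function.comp_apply]
      rw [Equiv.swap_apply_of_ne_of_ne (Fin.succ_ne_zero _) (by simpa using hx)]
      simp [hx]

theorem cons_cons_comp_swap_one_succ :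
    (Fin.cons a (Fin.cons b B) : Fin (k + 2) → Fin n) ∘ Equiv.swap 1 i.succ.succ =
      Fin.cons a (Fin.cons (B i) (Function.update B i b)) := by
  rw [← cons_comp_swap_zero_succ b B i]
  funext x
  refine Fin.cases ?_ (fun x => ?_) x
  · simp only [Function.comp_apply]
    rw [Equiv.swap_apply_of_ne_of_ne (by simp) (by simp [Fin.ext_iff])]
    simp
  · simp only [Function.comp_apply, Fin.cons_succ]
    rw [← Fin.succ_zero_eq_one, ← (Fin.succ_injective (k + 1)).map_swap]
    simp

theorem cons_cons_comp_swap_zero_succ :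
    (Fin.cons a (Fin.cons b B) : Fin (k + 2) → Fin n) ∘ Equiv.swap 0 i.succ.succ =
      Fin.cons (B i) (Fin.cons b (Function.update B i a)) := by
  rw [cons_comp_swap_zero_succ, Fin.cons_succ, ← Fin.cons_update]

end MultiIndex

namespace PseudoRiemannianMetric

variable {n : ℕ} {M : Type*} [TopologicalSpace M] [ChartedSpace (EuclideanSpace ℝ (Fin n)) M]
  {e : OpenPartialHomeomorph M (EuclideanSpace ℝ (Fin n))} {u : EuclideanSpace ℝ (Fin n)}
  (g : PseudoRiemannianMetric n M)

/-- Against a skew `Z` only the part of `R_{cads}` skew in `a, s` counts, and by Bianchi that part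
is `-R_{asdc}/2`. -/
theorem contract_riemann (he : e ∈ IsManifold.maximalAtlas (𝓡 n) ∞ M) (hu : u ∈ e.target)
    {Z : Fin n → Fin n → ℝ} (hZ : ∀ a b, Z a b = -Z b a) (c d : Fin n) :
    contract (g.inv e u) (fun a s => g.riemann e u c a d s) Z =
      -(1 / 2) * contract (g.inv e u) (fun a s => g.riemann e u a s d c) Z := by
  have h1 := contract_swap (g.inv_symm (e := e) (u := u)) hZ (fun a s => g.riemann e u c a d s)
  have h2 : (fun a s => g.riemann e u a s d c) = fun a s =>
      -1 * g.riemann e u c a d s + 1 * g.riemann e u c s d a := by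
    funext a s
    have b := g.riemann_bianchi (e := e) (u := u) c a d s
    have p1 := g.riemann_pair_symm he hu a s d c
    have p2 := g.riemann_pair_symm he hu c s d a
    have s1 := g.riemann_swap_left (e := e) (u := u) a d c s
    linarith
  rw [h2, contract_linear, h1]
  ring

/-- By pair symmetry, exchanging `c` and `d` transposes `a` and `s`, which flips the sign against a
skew `Z`. -/
theorem contract_riemann_add_swap (he : e ∈ IsManifold.maximalAtlas (𝓡 n) ∞ M)
    (hu : u ∈ e.target) {Z : Fin n → Fin n → ℝ} (hZ : ∀ a b, Z a b = -Z b a) (c d : Fin n) :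
    contract (g.inv e u) (fun a s => g.riemann e u c a d s) Z +
      contract (g.inv e u) (fun a s => g.riemann e u d a c s) Z = 0 := by
  have h1 := contract_swap (g.inv_symm (e := e) (u := u)) hZ (fun a s => g.riemann e u c a d s)
  have h2 : (fun a s => g.riemann e u d a c s) = fun a s => g.riemann e u c s d a := by
    funext a s
    exact g.riemann_pair_symm he hu d a c s
  rw [h2, h1]
  ring

theorem sum_inv_mul_sum_riemannUp (he : e ∈ IsManifold.maximalAtlas (𝓡 n) ∞ M)
    (hu : u ∈ e.target) (Z : Fin n → Fin n → ℝ) (c d : Fin n) :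
    ∑ a, ∑ b, g.inv e u a b * ∑ f, g.riemannUp e u c a d f * Z b f =
      contract (g.inv e u) (fun a s => g.riemann e u c a d s) Z := by
  simp only [contract, g.riemannUp_eq he hu, Finset.mul_sum, Finset.sum_mul]
  exact Finset.sum_congr rfl fun a _ => Finset.sum_congr rfl fun b _ => Finset.sum_congr rfl
    fun f _ => Finset.sum_congr rfl fun s _ => by ring

theorem sum_weylUp_mul (Z : Fin n → Fin n → ℝ) (c d : Fin n) :
    ∑ a, ∑ f, g.weylUp e u a f d c * Z a f =
      contract (g.inv e u) (fun a s => g.weyl e u a s d c) Z := by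
  simp only [contract, weylUp, Finset.sum_mul]
  conv_rhs => rw [Finset.sum_comm]
  refine Finset.sum_congr rfl fun a _ => ?_
  conv_rhs => rw [Finset.sum_comm]
  refine Finset.sum_congr rfl fun f _ => Finset.sum_congr rfl fun s _ =>
    Finset.sum_congr rfl fun t _ => ?_
  rw [g.inv_symm a s]

/-- The trace `γ^{ab} ((∇_c ∇_a - ∇_a ∇_c) Y)_{b d E}`, by the Ricci identity. -/
noncomputable def curvatureTrace {q : ℕ} (Y : SkewTensorField n M (q + 2))
    (e : OpenPartialHomeomorph M (EuclideanSpace ℝ (Fin n))) (u : EuclideanSpace ℝ (Fin n))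
    (c d : Fin n) (E : Fin q → Fin n) : ℝ :=
  ∑ a, ∑ b, g.inv e u a b * ∑ j, ∑ f, g.riemannUp e u c a
    ((Fin.cons b (Fin.cons d E) : Fin (q + 2) → Fin n) j) f *
      Y.comp e u (Function.update (Fin.cons b (Fin.cons d E)) j f)

end PseudoRiemannianMetric

theorem SkewTensorField.isSkew_comp {n : ℕ} {M : Type*} [TopologicalSpace M]
    [ChartedSpace (EuclideanSpace ℝ (Fin n)) M] {k : ℕ} (T : SkewTensorField n M k)
    (e : OpenPartialHomeomorph M (EuclideanSpace ℝ (Fin n))) (u : EuclideanSpace ℝ (Fin n)) :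
    IsSkew (T.comp e u) := by
  intro σ b
  unfold SkewTensorField.comp formComp
  have := (T.toFun (e.symm u)).map_perm (fun j => coordVec e u (b j)) σ
  rw [Units.smul_def, zsmul_eq_mul] at this
  exact this

namespace PseudoRiemannianMetric

variable {n : ℕ} {M : Type*} [TopologicalSpace M] [ChartedSpace (EuclideanSpace ℝ (Fin n)) M]
  {e : OpenPartialHomeomorph M (EuclideanSpace ℝ (Fin n))} {u : EuclideanSpace ℝ (Fin n)}
  (g : PseudoRiemannianMetric n M) {q : ℕ} (Y : SkewTensorField n M (q + 2))

/-- Of the three kinds of slots in the Ricci identity, the contracted slot gives a Ricci term skew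
in `c, d`, the slot `d` cancels by `contract_riemann_add_swap`, and the slots of `E` give the Weyl
expression through `contract_riemann`. -/
theorem curvatureTrace_add_swap (he : e ∈ IsManifold.maximalAtlas (𝓡 n) ∞ M)
    (hu : u ∈ e.target) {Λ : ℝ} (hΛ : ∀ a b, g.ricci e u a b = Λ * g.comp e u a b)
    (c d : Fin n) (E : Fin q → Fin n) :
    g.curvatureTrace Y e u c d E + g.curvatureTrace Y e u d c E =
      (1 / 2) * (g.weylContr e Y u c d E + g.weylContr e Y u d c E) := by
  have hY := Y.isSkew_comp e u
  have h01 : ∀ a b (B : Fin q → Fin n), Y.comp e u (Fin.cons a (Fin.cons b B)) =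
      -Y.comp e u (Fin.cons b (Fin.cons a B)) := by
    intro a b B
    rw [← cons_cons_comp_swap_zero_one, hY.swap (by simp)]
  have h0i : ∀ a b (B : Fin q → Fin n) i, Y.comp e u (Fin.cons a (Fin.cons b B)) =
      -Y.comp e u (Fin.cons (B i) (Fin.cons b (Function.update B i a))) := by
    intro a b B i
    rw [← cons_cons_comp_swap_zero_succ, hY.swap (Fin.succ_ne_zero _).symm, neg_neg]
  have hZ : ∀ d (i : Fin q) a b,
      Y.comp e u (Fin.cons a (Fin.cons d (Function.update E i b))) =
        -Y.comp e u (Fin.cons b (Fin.cons d (Function.update E i a))) := by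
    intro d i a b
    rw [h0i a d _ i]
    simp
  obtain ⟨κ, hκ⟩ := g.weyl_eq_of_ricci hΛ
  -- The two products of metrics in the non-Weyl part contribute equally because `Y` is skew, whence
  -- `2 * κ`; the overall sign comes from moving `d` past `a`.
  have hwc : ∀ c d, g.weylContr e Y u c d E = -∑ i, (contract (g.inv e u)
      (fun a s => g.riemann e u a s (E i) c)
      (fun a f => Y.comp e u (Fin.cons a (Fin.cons d (Function.update E i f)))) +
      2 * κ * Y.comp e u (Fin.cons (E i) (Fin.cons d (Function.update E i c)))) := by
    intro c d
    unfold weylContr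
    rw [← Finset.sum_neg_distrib]
    refine Finset.sum_congr rfl fun i _ => ?_
    simp only [h01 d, mul_neg, Finset.sum_neg_distrib]
    rw [g.sum_weylUp_mul (fun a f => Y.comp e u (Fin.cons a (Fin.cons d (Function.update E i f))))]
    have hW : (fun a s => g.weyl e u a s (E i) c) = fun a s => 1 * g.riemann e u a s (E i) c +
        κ * (1 * (g.comp e u a (E i) * g.comp e u s c) +
          -1 * (g.comp e u a c * g.comp e u s (E i))) := by
      funext a s
      rw [hκ]
      ring
    rw [hW, contract_linear, contract_linear,
      contract_mul_self (g.sum_inv_mul_comp he hu) g.inv_symm,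
      contract_mul_self (g.sum_inv_mul_comp he hu) g.inv_symm, hZ d i c (E i)]
    ring
  have hS : ∀ c d, g.curvatureTrace Y e u c d E =
      -Λ * Y.comp e u (Fin.cons c (Fin.cons d E)) +
      (contract (g.inv e u) (fun a s => g.riemann e u c a d s)
        (fun b f => Y.comp e u (Fin.cons b (Fin.cons f E))) +
      ∑ i, contract (g.inv e u) (fun a s => g.riemann e u c a (E i) s)
        (fun b f => Y.comp e u (Fin.cons b (Fin.cons d (Function.update E i f))))) := by
    intro c d
    simp only [← g.sum_inv_mul_sum_riemannUp he hu]
    unfold curvatureTrace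
    simp only [Fin.sum_univ_succ (n := q + 1), Fin.sum_univ_succ (n := q), Fin.cons_zero,
      Fin.cons_succ, Fin.update_cons_zero, ← Fin.cons_update, mul_add, Finset.sum_add_distrib]
    congr 1
    · have := g.sum_inv_mul_riemannUp he hu hΛ c
      simp only [Finset.mul_sum, ← mul_assoc]
      rw [Finset.sum_comm_cycle]
      simp only [← Finset.sum_mul, this]
      simp
    · congr 1
      simp only [Finset.mul_sum]
      exact Finset.sum_comm_cycle
  rw [hS c d, hS d c, hwc c d, hwc d c, h01 c d]
  have h2 := g.contract_riemann_add_swap he hu (fun a b => h01 a b E) c d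
  have h3 : ∀ c d, ∑ i, contract (g.inv e u) (fun a s => g.riemann e u c a (E i) s)
        (fun b f => Y.comp e u (Fin.cons b (Fin.cons d (Function.update E i f)))) =
      -(1 / 2) * ∑ i, contract (g.inv e u) (fun a s => g.riemann e u a s (E i) c)
        (fun b f => Y.comp e u (Fin.cons b (Fin.cons d (Function.update E i f)))) := by
    intro c d
    rw [Finset.mul_sum]
    exact Finset.sum_congr rfl fun i _ => g.contract_riemann he hu (hZ d i) c (E i)
  -- The `κ` terms are skew in `c, d`: each is, up to sign, `Y` with `E` unchanged and `c, d` in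
  -- front.
  have h4 : ∑ i, Y.comp e u (Fin.cons (E i) (Fin.cons d (Function.update E i c))) +
      ∑ i, Y.comp e u (Fin.cons (E i) (Fin.cons c (Function.update E i d))) = 0 := by
    rw [← Finset.sum_add_distrib]
    refine Finset.sum_eq_zero fun i _ => ?_
    rw [h01 (E i) d, h01 (E i) c, h0i d _ _ i]
    simp
  simp only [h3, Finset.sum_add_distrib, ← Finset.mul_sum]
  linear_combination h2 + κ * h4

end PseudoRiemannianMetric

/-! ### The conformal Killing-Yano equation and its first derivative -/

namespace PseudoRiemannianMetric

variable {n : ℕ} {M : Type*} [TopologicalSpace M] [ChartedSpace (EuclideanSpace ℝ (Fin n)) M]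
  {e : OpenPartialHomeomorph M (EuclideanSpace ℝ (Fin n))} {u : EuclideanSpace ℝ (Fin n)}
  {g : PseudoRiemannianMetric n M} {k : ℕ} {Y : SkewTensorField n M (k + 1)}
  {h : SkewTensorField n M k}

theorem traceTerm_eq_skewPart (a b : Fin n) (B : Fin k → Fin n) :
    2 * skewPart (fun c : Fin (k + 1) → Fin n =>
        g.comp e u a (c 0) * h.comp e u (Fin.tail c)) (Fin.cons b B)
      + 2 * skewPart (fun c : Fin (k + 1) → Fin n =>
        g.comp e u b (c 0) * h.comp e u (Fin.tail c)) (Fin.cons a B) =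
    2 / ((k : ℝ) + 1) * traceTerm (g.comp e u) (h.comp e u) a b B := by
  rw [skewPart_mul _ _ (h.isSkew_comp e u), skewPart_mul _ _ (h.isSkew_comp e u), traceTerm,
    g.comp_symm b a, Finset.sum_add_distrib]
  ring

theorem CKYEquation.nabla_add_nabla (hY : g.CKYEquation Y h)
    (he : e ∈ IsManifold.maximalAtlas (𝓡 n) ∞ M) (hu : u ∈ e.target) (a b : Fin n)
    (B : Fin k → Fin n) :
    g.nabla e (Y.comp e) u a (Fin.cons b B) + g.nabla e (Y.comp e) u b (Fin.cons a B) =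
      2 / ((k : ℝ) + 1) * traceTerm (g.comp e u) (h.comp e u) a b B :=
  (hY e he u hu a b B).trans (traceTerm_eq_skewPart a b B)

theorem isKillingYano_iff : g.IsKillingYano Y ↔
    ∀ e ∈ IsManifold.maximalAtlas (𝓡 n) ∞ M, ∀ u ∈ e.target, ∀ (a b : Fin n) (B : Fin k → Fin n),
      g.nabla e (Y.comp e) u a (Fin.cons b B) + g.nabla e (Y.comp e) u b (Fin.cons a B) = 0 := by
  unfold IsKillingYano CKYEquation
  simp only [traceTerm_eq_skewPart]
  have : ∀ e u (B : Fin k → Fin n), (0 : SkewTensorField n M k).comp e u B = 0 :=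
    fun _ _ _ => rfl
  simp [traceTerm, this]

/-- The right-hand side of the conformal Killing-Yano equation is determined by the divergence. -/
theorem CKYEquation.comp_eq_of_isDivergence {h' : SkewTensorField n M k} (hk : k < n)
    (hY : g.CKYEquation Y h) (hdiv : g.IsDivergence Y h')
    (he : e ∈ IsManifold.maximalAtlas (𝓡 n) ∞ M) (hu : u ∈ e.target) (B : Fin k → Fin n) :
    h.comp e u B = h'.comp e u B := by
  have hd := hdiv e he u hu B
  have ht := sum_mul_traceTerm g.comp_symm g.inv_symm (g.sum_inv_mul_comp he hu) (h.comp e u) B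
  have e1 : ∑ a, ∑ b, g.inv e u a b * (g.nabla e (Y.comp e) u a (Fin.cons b B) +
      g.nabla e (Y.comp e) u b (Fin.cons a B)) = 2 / ((k : ℝ) + 1) *
        (2 * ((n : ℝ) - k) * h.comp e u B) := by
    rw [← ht]
    simp only [hY.nabla_add_nabla he hu, Finset.mul_sum]
    exact Finset.sum_congr rfl fun a _ => Finset.sum_congr rfl fun b _ => by ring
  have e2 : ∑ a, ∑ b, g.inv e u a b * g.nabla e (Y.comp e) u a (Fin.cons b B) =
      ∑ a, ∑ b, g.inv e u a b * g.nabla e (Y.comp e) u b (Fin.cons a B) := by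
    rw [Finset.sum_comm]
    exact Finset.sum_congr rfl fun a _ => Finset.sum_congr rfl fun b _ => by rw [g.inv_symm]
  simp only [mul_add, Finset.sum_add_distrib, e2] at e1
  have hnk : (n : ℝ) - k ≠ 0 := by
    have : (k : ℝ) < n := by exact_mod_cast hk
    linarith
  have hk1 : (k : ℝ) + 1 ≠ 0 := by positivity
  have e3 : ∑ a, ∑ b, g.inv e u a b * g.nabla e (Y.comp e) u b (Fin.cons a B) =
      2 / ((k : ℝ) + 1) * (((n : ℝ) - k) * h.comp e u B) := by linarith
  rw [hd, e3]
  push_cast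
  rw [show (n : ℝ) + 1 - (k + 1) = n - k by ring]
  field_simp

variable (g Y) in
/-- The components `∇_c ∇_a Y_B` of the second covariant derivative. -/
noncomputable def nabla₂ (e : OpenPartialHomeomorph M (EuclideanSpace ℝ (Fin n)))
    (u : EuclideanSpace ℝ (Fin n)) (c a : Fin n) (B : Fin (k + 1) → Fin n) : ℝ :=
  g.nabla e (fun v (I : Fin (k + 2) → Fin n) => g.nabla e (Y.comp e) v (I 0) (Fin.tail I)) u c
    (Fin.cons a B)

theorem contDiffOn_skewTensorField_comp {k : ℕ} (T : SkewTensorField n M k)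
    (he : e ∈ IsManifold.maximalAtlas (𝓡 n) ∞ M) (b : Fin k → Fin n) :
    ContDiffOn ℝ ∞ (fun v => T.comp e v b) e.target :=
  T.smooth e he b

/-- The covariant derivative of the conformal Killing-Yano equation. -/
theorem nabla₂_add_nabla₂ {h : EuclideanSpace ℝ (Fin n) → (Fin k → Fin n) → ℝ}
    (he : e ∈ IsManifold.maximalAtlas (𝓡 n) ∞ M)
    (hh : ∀ b, ContDiffOn ℝ ∞ (fun v => h v b) e.target) {r : ℝ}
    (hY : ∀ v ∈ e.target, ∀ a b B, g.nabla e (Y.comp e) v a (Fin.cons b B) +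
      g.nabla e (Y.comp e) v b (Fin.cons a B) = r * traceTerm (g.comp e v) (h v) a b B)
    (hu : u ∈ e.target) (c a b : Fin n) (B : Fin k → Fin n) :
    g.nabla₂ Y e u c a (Fin.cons b B) + g.nabla₂ Y e u c b (Fin.cons a B) =
      r * traceTerm (g.comp e u) (g.nabla e h u c) a b B := by
  let D : EuclideanSpace ℝ (Fin n) → (Fin (k + 2) → Fin n) → ℝ := fun v I =>
    g.nabla e (Y.comp e) v (I 0) (Fin.tail I)
  let G : EuclideanSpace ℝ (Fin n) → (Fin (k + 2) → Fin n) → ℝ := fun v I =>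
    g.comp e v (I 0) (I 1) * h v (Fin.tail (Fin.tail I))
  have hD : ∀ I, DifferentiableAt ℝ (fun v => D v I) u := fun I =>
    differentiableAt_of_contDiffOn e.open_target hu
      (g.contDiffOn_nabla he (contDiffOn_skewTensorField_comp Y he) _ _)
  have hG : ∀ I, DifferentiableAt ℝ (fun v => G v I) u := fun I =>
    differentiableAt_of_contDiffOn e.open_target hu ((g.contDiffOn_comp he _ _).mul (hh _))
  have hG2 : ∀ (σ τ : Equiv.Perm (Fin (k + 2))) I,
      DifferentiableAt ℝ (fun v => G v (I ∘ σ) + G v (I ∘ τ)) u :=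
    fun σ τ I => (hG _).fun_add (hG _)
  -- The equation is recast as a relation between slot permutations of `D = ∇Y` and `G = g ⊗ h`. `∇`
  -- commutes with the permutations, and passes through `g` because `∇g = 0`.
  have heq : ∀ v ∈ e.target, ∀ I, D v I + D v (I ∘ Equiv.swap 0 1) =
      r * (2 * G v I + -1 * ∑ i : Fin k, (G v (I ∘ Equiv.swap 1 i.succ.succ) +
        G v (I ∘ Equiv.swap 0 i.succ.succ))) := by
    intro v hv I
    obtain ⟨a, I, rfl⟩ : ∃ x I', I = Fin.cons x I' := ⟨I 0, Fin.tail I, (Fin.cons_self_tail I).symm⟩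
    obtain ⟨b, B, rfl⟩ : ∃ x I', I = Fin.cons x I' := ⟨I 0, Fin.tail I, (Fin.cons_self_tail I).symm⟩
    simp only [cons_cons_comp_swap_zero_one, cons_cons_comp_swap_one_succ,
      cons_cons_comp_swap_zero_succ, D, G, Fin.cons_zero, Fin.cons_one, Fin.tail_cons]
    rw [hY v hv, traceTerm]
    simp only [g.comp_symm (_ : Fin n) b]
    ring
  have hcongr := g.nabla_congr hu heq c (Fin.cons a (Fin.cons b B))
  rw [nabla_add g hD (fun I => hD _), nabla_const_mul g r (fun I =>
      ((hG I).const_mul 2).fun_add ((DifferentiableAt.fun_sum fun i _ => hG2 _ _ I).const_mul (-1))),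
    nabla_add g (fun I => (hG I).const_mul 2)
      (fun I => (DifferentiableAt.fun_sum fun i _ => hG2 _ _ I).const_mul (-1)),
    nabla_const_mul g 2 hG, nabla_const_mul g (-1)
      (fun I => DifferentiableAt.fun_sum fun i _ => hG2 _ _ I),
    nabla_sum g _ (fun i I => hG2 _ _ I)] at hcongr
  have hnG : ∀ I, g.nabla e G u c I = g.comp e u (I 0) (I 1) *
      g.nabla e h u c (Fin.tail (Fin.tail I)) := fun I =>
    g.nabla_comp_mul he hu (fun b => differentiableAt_of_contDiffOn e.open_target hu (hh b)) c I
  simp only [nabla_add g (fun I => hG _) (fun I => hG _), nabla_comp_perm] at hcongr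
  simp only [hnG, cons_cons_comp_swap_zero_one, cons_cons_comp_swap_one_succ,
    cons_cons_comp_swap_zero_succ, Fin.cons_zero, Fin.cons_one, Fin.tail_cons] at hcongr
  refine hcongr.trans ?_
  rw [traceTerm]
  simp only [g.comp_symm (_ : Fin n) b]
  ring

theorem nabla_comp_perm_of_eq_neg {T : EuclideanSpace ℝ (Fin n) → (Fin k → Fin n) → ℝ}
    {σ : Equiv.Perm (Fin k)} (hT : ∀ v ∈ e.target, ∀ b, T v (b ∘ σ) = -T v b)
    (hd : ∀ b, DifferentiableAt ℝ (fun v => T v b) u) (hu : u ∈ e.target) (a : Fin n)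
    (b : Fin k → Fin n) : g.nabla e T u a (b ∘ σ) = -g.nabla e T u a b := by
  rw [← nabla_comp_perm, g.nabla_congr hu (T₂ := fun v b => -1 * T v b)
    (fun v hv b => by rw [hT v hv, neg_one_mul]), nabla_const_mul g _ hd, neg_one_mul]

theorem nabla₂_skew {q : ℕ} (Y : SkewTensorField n M (q + 2))
    (he : e ∈ IsManifold.maximalAtlas (𝓡 n) ∞ M) (hu : u ∈ e.target) (c a b d : Fin n)
    (E : Fin q → Fin n) : g.nabla₂ Y e u c a (Fin.cons b (Fin.cons d E)) =
      -g.nabla₂ Y e u c a (Fin.cons d (Fin.cons b E)) := by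
  have hY := fun b v (hv : v ∈ e.target) => differentiableAt_of_contDiffOn e.open_target hv
    (contDiffOn_skewTensorField_comp Y he b)
  have hswap : ∀ a b d (E : Fin q → Fin n),
      (Fin.cons a (Fin.cons b (Fin.cons d E)) : Fin (q + 3) → Fin n) ∘
        Equiv.swap 1 (0 : Fin (q + 1)).succ.succ = Fin.cons a (Fin.cons d (Fin.cons b E)) := by
    intro a b d E
    rw [cons_cons_comp_swap_one_succ, Fin.cons_zero, Fin.update_cons_zero]
  have h1 : ∀ v ∈ e.target, ∀ I : Fin (q + 3) → Fin n,
      g.nabla e (Y.comp e) v ((I ∘ Equiv.swap 1 (0 : Fin (q + 1)).succ.succ) 0)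
        (Fin.tail (I ∘ Equiv.swap 1 (0 : Fin (q + 1)).succ.succ)) =
      -g.nabla e (Y.comp e) v (I 0) (Fin.tail I) := by
    intro v hv I
    obtain ⟨a, I, rfl⟩ : ∃ x I', I = Fin.cons x I' := ⟨I 0, Fin.tail I, (Fin.cons_self_tail I).symm⟩
    obtain ⟨b, I, rfl⟩ : ∃ x I', I = Fin.cons x I' := ⟨I 0, Fin.tail I, (Fin.cons_self_tail I).symm⟩
    obtain ⟨d, E, rfl⟩ : ∃ x I', I = Fin.cons x I' := ⟨I 0, Fin.tail I, (Fin.cons_self_tail I).symm⟩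
    rw [hswap, Fin.cons_zero, Fin.cons_zero, Fin.tail_cons, Fin.tail_cons,
      ← cons_cons_comp_swap_zero_one]
    exact nabla_comp_perm_of_eq_neg (fun v _ b => (Y.isSkew_comp e v).swap (by simp) b)
      (fun b => hY b v hv) hv _ _
  unfold nabla₂
  rw [← hswap]
  exact nabla_comp_perm_of_eq_neg h1 (fun I => differentiableAt_of_contDiffOn e.open_target hu
    (g.contDiffOn_nabla he (contDiffOn_skewTensorField_comp Y he) _ _)) hu _ _

theorem sum_inv_mul_nabla₂_sub {q : ℕ} (Y : SkewTensorField n M (q + 2))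
    (he : e ∈ IsManifold.maximalAtlas (𝓡 n) ∞ M) (hu : u ∈ e.target) (c d : Fin n)
    (E : Fin q → Fin n) :
    ∑ a, ∑ b, g.inv e u a b * (g.nabla₂ Y e u c a (Fin.cons b (Fin.cons d E)) -
      g.nabla₂ Y e u a c (Fin.cons b (Fin.cons d E))) = g.curvatureTrace Y e u c d E := by
  unfold nabla₂ curvatureTrace
  simp only [g.nabla_nabla_sub he hu (contDiffOn_skewTensorField_comp Y he)]

/-- On an Einstein space, the symmetrized covariant derivative of the divergence of a conformal
Killing-Yano tensor is determined by the Weyl tensor, up to a divergence term. -/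
theorem weylContr_add_swap {q : ℕ} (hq : q + 2 < n) {Y : SkewTensorField n M (q + 2)}
    {h : SkewTensorField n M (q + 1)} (hY : g.IsCKY Y) (hdiv : g.IsDivergence Y h)
    (he : e ∈ IsManifold.maximalAtlas (𝓡 n) ∞ M) (hu : u ∈ e.target)
    {Λ : ℝ} (hΛ : ∀ a b, g.ricci e u a b = Λ * g.comp e u a b) (c d : Fin n) (E : Fin q → Fin n) :
    (1 / 2) * (g.weylContr e Y u c d E + g.weylContr e Y u d c E) = 2 / ((q : ℝ) + 2) *
      (((n : ℝ) - q - 2) * (g.nabla e (h.comp e) u c (Fin.cons d E) +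
          g.nabla e (h.comp e) u d (Fin.cons c E)) +
        traceTerm (g.comp e u) (fun E => ∑ a, ∑ b, g.inv e u a b *
          g.nabla e (h.comp e) u a (Fin.cons b E)) c d E) := by
  obtain ⟨h', hY⟩ := hY
  -- The tensor supplied by the CKY hypothesis agrees with `h` on the whole chart, so it may be
  -- replaced before differentiating.
  have hN := fun c a b B => nabla₂_add_nabla₂ he (contDiffOn_skewTensorField_comp h he)
    (fun v hv a b B => by
      have := hY.nabla_add_nabla he hv a b B
      rwa [funext fun B => hY.comp_eq_of_isDivergence (by omega) hdiv he hv B] at this) hu c a b B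
  rw [← g.curvatureTrace_add_swap Y he hu hΛ, ← sum_inv_mul_nabla₂_sub Y he hu,
    ← sum_inv_mul_nabla₂_sub Y he hu]
  have := sum_mul_sub_add_sum_mul_sub g.comp_symm g.inv_symm (g.sum_inv_mul_comp he hu) hN
    (fun c a b d E => nabla₂_skew Y he hu c a b d E) c d E
  rw [this]
  push_cast
  ring

theorem isKillingYano_iff_weylCondition {q : ℕ} (hq : q + 2 < n) (hg : g.IsEinstein)
    {Y : SkewTensorField n M (q + 2)} {h : SkewTensorField n M (q + 1)} (hY : g.IsCKY Y)
    (hdiv : g.IsDivergence Y h) : g.IsKillingYano h ↔ g.WeylCondition Y := by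
  obtain ⟨Λ, hΛ⟩ := hg
  have hq2 : (q : ℝ) + 2 ≠ 0 := by positivity
  have hqn : (q : ℝ) + 2 < n := by exact_mod_cast hq
  rw [isKillingYano_iff]
  constructor
  · intro hKY e he u hu c d E
    -- A Killing–Yano tensor is divergence-free: its covariant derivative is skew in the two
    -- contracted indices.
    have hδ : ∀ E : Fin q → Fin n, ∑ a, ∑ b, g.inv e u a b *
        g.nabla e (h.comp e) u a (Fin.cons b E) = 0 := by
      intro E
      have e1 : ∑ a, ∑ b, g.inv e u a b * g.nabla e (h.comp e) u a (Fin.cons b E) =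
          -∑ a, ∑ b, g.inv e u a b * g.nabla e (h.comp e) u a (Fin.cons b E) := by
        conv_lhs => rw [Finset.sum_comm]
        simp only [← Finset.sum_neg_distrib]
        refine Finset.sum_congr rfl fun a _ => Finset.sum_congr rfl fun b _ => ?_
        rw [g.inv_symm b a]
        linear_combination g.inv e u a b * hKY e he u hu a b E
      linarith
    rw [weylContr_add_swap hq hY hdiv he hu (hΛ e he u hu), hKY e he u hu]
    simp only [traceTerm, hδ, mul_zero, add_zero, Finset.sum_const_zero, sub_zero]
  · intro hW e he u hu c d E
    have hkey := fun c d E => (weylContr_add_swap hq hY hdiv he hu (hΛ e he u hu) c d E).symm.trans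
      (hW e he u hu c d E)
    have hkey' : ∀ c d E, ((n : ℝ) - q - 2) * (g.nabla e (h.comp e) u c (Fin.cons d E) +
          g.nabla e (h.comp e) u d (Fin.cons c E)) +
        traceTerm (g.comp e u) (fun E => ∑ a, ∑ b, g.inv e u a b *
          g.nabla e (h.comp e) u a (Fin.cons b E)) c d E = 0 := fun c d E =>
      (mul_eq_zero.1 (hkey c d E)).resolve_left (div_ne_zero two_ne_zero hq2)
    -- Trace of `hkey'` over `c, d`: the first term contributes `2(n - q - 2)` and `traceTerm`
    -- contributes `2(n - q)`, in total `4(n - q - 1)`, which is positive.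
    have hδ : ∀ E : Fin q → Fin n, ∑ a, ∑ b, g.inv e u a b *
        g.nabla e (h.comp e) u a (Fin.cons b E) = 0 := by
      intro E
      have ht := sum_mul_traceTerm g.comp_symm g.inv_symm (g.sum_inv_mul_comp he hu)
        (fun E => ∑ a, ∑ b, g.inv e u a b * g.nabla e (h.comp e) u a (Fin.cons b E)) E
      have e1 : ∑ a, ∑ b, g.inv e u a b * g.nabla e (h.comp e) u a (Fin.cons b E) =
          ∑ a, ∑ b, g.inv e u a b * g.nabla e (h.comp e) u b (Fin.cons a E) := by
        rw [Finset.sum_comm]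
        exact Finset.sum_congr rfl fun a _ => Finset.sum_congr rfl fun b _ => by rw [g.inv_symm]
      have e2 : ∀ a b, g.inv e u a b * traceTerm (g.comp e u) (fun E => ∑ a, ∑ b,
          g.inv e u a b * g.nabla e (h.comp e) u a (Fin.cons b E)) a b E =
          -((n : ℝ) - q - 2) * (g.inv e u a b * g.nabla e (h.comp e) u a (Fin.cons b E)) +
          -((n : ℝ) - q - 2) * (g.inv e u a b * g.nabla e (h.comp e) u b (Fin.cons a E)) := by
        intro a b
        linear_combination g.inv e u a b * hkey' a b E
      simp only [e2, Finset.sum_add_distrib, ← Finset.mul_sum, ← e1] at ht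
      have h4 : (4 * ((n : ℝ) - q - 1)) * ∑ a, ∑ b, g.inv e u a b *
          g.nabla e (h.comp e) u a (Fin.cons b E) = 0 := by linear_combination -ht
      exact (mul_eq_zero.1 h4).resolve_left (by linarith)
    have := hkey' c d E
    simp only [traceTerm, hδ] at this
    simp only [mul_zero, add_zero, Finset.sum_const_zero, sub_zero] at this
    exact (mul_eq_zero.1 this).resolve_left (by linarith)

/-! ### The metric dual of a one-form, and the main theorem -/

/-- Nondegeneracy makes the map from the tangent space to its dual injective, hence surjective by
equality of dimensions. -/
theorem exists_form_eq (g : PseudoRiemannianMetric n M) (x : M)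
    (w : TangentSpace (𝓡 n) x →ₗ[ℝ] ℝ) :
    ∃ X : TangentSpace (𝓡 n) x, ∀ v, g.form x X v = w v := by
  have : FiniteDimensional ℝ (TangentSpace (𝓡 n) x) :=
    inferInstanceAs (FiniteDimensional ℝ (EuclideanSpace ℝ (Fin n)))
  have hinj : Function.Injective (g.form x) := by
    rw [← LinearMap.ker_eq_bot, LinearMap.ker_eq_bot']
    exact fun v hv => g.nondegenerate x v fun w => by rw [hv]; rfl
  obtain ⟨X, hX⟩ := (LinearMap.injective_iff_surjective_of_finrank_eq_finrank
    (Subspace.dual_finrank_eq (K := ℝ) (V := TangentSpace (𝓡 n) x)).symm).1 hinj w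
  exact ⟨X, fun v => by rw [hX]⟩

theorem isKillingVector_of_isKillingYano {h : SkewTensorField n M 1} (hh : g.IsKillingYano h)
    {X : ∀ x : M, TangentSpace (𝓡 n) x}
    (hX : ∀ (x : M) (v : TangentSpace (𝓡 n) x), g.form x (X x) v = h.toFun x (fun _ => v)) :
    g.IsKillingVector X := by
  intro e he u hu a b
  have h1 : (fun v (i : Fin 1 → Fin n) =>
      g.form (e.symm v) (X (e.symm v)) (coordVec e v (i 0))) = h.comp e := by
    funext v i
    rw [hX]
    unfold SkewTensorField.comp formComp
    congr 1
    funext j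
    rw [Subsingleton.elim j 0]
  rw [h1]
  have h2 := isKillingYano_iff.1 hh e he u hu a b Fin.elim0
  have h3 : ∀ b : Fin n, (Fin.cons b Fin.elim0 : Fin 1 → Fin n) = fun _ => b := fun b => by
    funext j
    exact Fin.cases rfl (fun j => j.elim0) j
  rwa [h3, h3] at h2

end PseudoRiemannianMetric

end KillingYano

theorem mainTheorem5 {n q : ℕ} (hq : q + 2 < n)
    {M : Type*} [TopologicalSpace M] [ChartedSpace (EuclideanSpace ℝ (Fin n)) M]
    [IsManifold (𝓡 n) ∞ M]
    (g : KillingYano.PseudoRiemannianMetric n M) (hg : g.IsEinstein)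
    (Y : KillingYano.SkewTensorField n M (q + 2)) (hY : g.IsCKY Y)
    (h : KillingYano.SkewTensorField n M (q + 1)) (hdiv : g.IsDivergence Y h)
    (hne : ∃ x : M, h.toFun x ≠ 0) :
    (g.IsKillingYano h ↔ g.WeylCondition Y) ∧
      (q = 0 → g.WeylCondition Y ∧ g.IsKillingYano h ∧
        ∃ X : ∀ x : M, TangentSpace (𝓡 n) x,
          (∀ (x : M) (v : TangentSpace (𝓡 n) x), g.form x (X x) v = h.toFun x (fun _ => v)) ∧
            g.IsKillingVector X) := by
  have hiff := KillingYano.PseudoRiemannianMetric.isKillingYano_iff_weylCondition hq hg hY hdiv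
  refine ⟨hiff, ?_⟩
  rintro rfl
  have hW : g.WeylCondition Y := by
    intro e _ u _ c d E
    simp [KillingYano.PseudoRiemannianMetric.weylContr]
  -- For `q = 0` the tensor `h` has rank one; `AlternatingMap.ofSubsingleton` identifies it with a
  -- linear functional, to be dualized pointwise.
  choose X hX using fun x => g.exists_form_eq x
    ((AlternatingMap.ofSubsingleton ℝ (TangentSpace (𝓡 n) x) ℝ (0 : Fin 1)).symm (h.toFun x))
  have hX' : ∀ (x : M) (v : TangentSpace (𝓡 n) x), g.form x (X x) v = h.toFun x (fun _ => v) := by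
    intro x v
    rw [hX]
    rfl
  exact ⟨hW, hiff.2 hW, X, hX',
    KillingYano.PseudoRiemannianMetric.isKillingVector_of_isKillingYano (hiff.2 hW) hX'⟩
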